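/- Let $d\ge 1$, $R>0$, $0<U<1$, and let $\mathcal S_c$ be the set of Borel functions $g:\mathbb R^d\to[0,1]$ with compact support; $\operatorname{Supp}(g)$ is the closed support of $g$, $B(c,R)$ is the closed Euclidean ball, $A^R$ is the set of points at distance at most $R$ from $A$, and $|A|$ is Lebesgue measure. For $g\in\mathcal S_c$, $c\in\mathbb R^d$ and $v\in[0,1]$ put $$g_{(c,v)}(y)=g(y)+U\,\mathbf 1_{\{\|y-c\|\le R\}}\bigl(\mathbf 1_{\{v\le g(c)\}}-g(y)\bigr),\qquad y\in\mathbb R^d .$$ Let $(X_t)_{t\ge0}$ be the two-type spatial $\Lambda$-Fleming–Viot process with radius $R$ and impact $U$, that is, the Markov jump process on $\mathcal S_c$ with generator $$\mathcal L G(g)=\int_{\operatorname{Supp}(g)^R}\int_0^1\bigl[G(g_{(c,v)})-G(g)\bigr]\,dv\,dc ,$$ given by its jump chain and holding times: $X_t=Y_n$ for $T_n\le t<T_{n+1}$, where $T_0=0$, $T_{n+1}=T_n+E_{n+1}/|\operatorname{Supp}(Y_n)^R|$ and $Y_{n+1}=(Y_n)_{(C_{n+1},V_{n+1})}$, and where,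 conditionally on the past up to the $n$-th event, $E_{n+1}$ is exponential of parameter $1$, $C_{n+1}$ is uniform on $\operatorname{Supp}(Y_n)^R$, $V_{n+1}$ is uniform on $[0,1]$, and these three are independent (the state $0$ is absorbing). That $T_n\to\infty$ is not assumed; nothing is required of $X_t$ for $t\ge\lim_n T_n$. Suppose that $X_0=f$ is deterministic, where $f:\mathbb R^d\to[0,1]$ is Borel with bounded support. Then there are a random set $B\subset\mathbb R^d$ and a finite random time $T$ such that, almost surely, $B$ is bounded, for all $t>T$ $$\{y: X_t(y)\neq 0\}=B\qquad\text{(and hence } \operatorname{Supp}(X_t)=\overline B),$$ and moreover $$\sup_{z\in B}X_t(z)\longrightarrow 0\qquad\text{as } t\to\infty .$$ -/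

import Mathlib

open MeasureTheory ProbabilityTheory Filter Topology
open scoped NNReal ENNReal

/-- The effect of a reproduction event with centre `c` and mark `v` on the state `g`, where `g y`
is the frequency of the Red type at `y`: the parent, located at `c`, is Red iff `v ≤ g c`, and a
proportion `U` of the population in the closed ball of centre `c` and radius `R` is replaced by
offspring of the parent. -/
noncomputable def reproduce {d : ℕ} (R U : ℝ) (c : EuclideanSpace ℝ (Fin d)) (v : ℝ)
    (g : EuclideanSpace ℝ (Fin d) → ℝ) : EuclideanSpace ℝ (Fin d) → ℝ :=
  fun y => g y + U * (Metric.closedBall c R).indicator 1 y * ((if v ≤ g c then 1 else 0) - g y)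

/-- The set of the centres of those events that can affect the state `g`: the points at distance
at most `R` from the (closed) support of `g`. -/
def activeCentres {d : ℕ} (R : ℝ) (g : EuclideanSpace ℝ (Fin d) → ℝ) :
    Set (EuclideanSpace ℝ (Fin d)) :=
  Metric.cthickening R (tsupport g)

/-- The total jump rate in the state `g`: the volume of the set of active centres. -/
noncomputable def jumpRate {d : ℕ} (R : ℝ) (g : EuclideanSpace ℝ (Fin d) → ℝ) : ℝ≥0∞ :=
  volume (activeCentres R g)

open Classical in
/-- The law of the centre of the next event in the state `g`: uniform on the active centres.
In the absorbing state `g = 0` there is no next event (the holding time is infinite), and the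
value is a dummy. -/
noncomputable def centreLaw {d : ℕ} (R : ℝ) (g : EuclideanSpace ℝ (Fin d) → ℝ) :
    Measure (EuclideanSpace ℝ (Fin d)) :=
  if g = 0 then Measure.dirac 0 else ProbabilityTheory.cond volume (activeCentres R g)

/-- The joint law, in the state `g`, of the normalised holding time, exponential of parameter `1`,
of the centre of the next event, and of its mark, uniform on `[0, 1]`; the three are
independent. -/
noncomputable def eventLaw {d : ℕ} (R : ℝ) (g : EuclideanSpace ℝ (Fin d) → ℝ) :
    Measure (ℝ × EuclideanSpace ℝ (Fin d) × ℝ) :=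
  (expMeasure 1).prod ((centreLaw R g).prod (volume.restrict (Set.Icc 0 1)))

/-- The successive states of the process started from `f`, when the successive events have the
centres `c 0, c 1, …` and the marks `v 0, v 1, …`. -/
noncomputable def jumpChain {d : ℕ} (R U : ℝ) (f : EuclideanSpace ℝ (Fin d) → ℝ)
    (c : ℕ → EuclideanSpace ℝ (Fin d)) (v : ℕ → ℝ) : ℕ → EuclideanSpace ℝ (Fin d) → ℝ
  | 0 => f
  | n + 1 => reproduce R U (c n) (v n) (jumpChain R U f c v n)

/-- The time of the `n`-th event (`0` for `n = 0`), when the normalised holding times are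
`e 0, e 1, …`: the holding time in a state is `e n` divided by the jump rate of this state, which
is infinite if the rate is `0`. -/
noncomputable def jumpTime {d : ℕ} (R U : ℝ) (f : EuclideanSpace ℝ (Fin d) → ℝ)
    (e : ℕ → ℝ) (c : ℕ → EuclideanSpace ℝ (Fin d)) (v : ℕ → ℝ) : ℕ → ℝ≥0∞
  | 0 => 0
  | n + 1 => jumpTime R U f e c v n + ENNReal.ofReal (e n) / jumpRate R (jumpChain R U f c v n)

/-- `X` is, under `μ`, a two-type spatial Λ-Fleming-Viot process with radius `R` and impact `U`
started from `f`, that is, a Markov jump process, with state space the Borel functions from `ℝ^d`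
to `[0, 1]` of compact support, in which every `g` jumps to `reproduce R U c v g` at rate `dc dv`
for `c` active and `v ∈ [0, 1]`. It is described by its jump chain and its holding times: given the
past `𝓕 n` up to the `n`-th event, the normalised holding time, the centre and the mark that lead
to the next event have the law `eventLaw R g`, where `g` is the current state, and `X` stays in
this state from the `n`-th event to the next one. Nothing is required of `X` beyond the limit of
the event times, should this limit be finite. -/
def IsSpatialFlemingViot {d : ℕ} {Ω : Type*} [mΩ : MeasurableSpace Ω] (μ : Measure Ω) (R U : ℝ)
    (f : EuclideanSpace ℝ (Fin d) → ℝ) (X : ℝ≥0 → Ω → EuclideanSpace ℝ (Fin d) → ℝ) : Prop :=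
  ∃ (𝓕 : Filtration ℕ mΩ) (e : ℕ → Ω → ℝ) (c : ℕ → Ω → EuclideanSpace ℝ (Fin d))
    (v : ℕ → Ω → ℝ),
    (∀ n, Measurable[𝓕 (n + 1)] fun ω => (e n ω, c n ω, v n ω)) ∧
    (∀ n, ∀ A : Set Ω, MeasurableSet[𝓕 n] A →
      ∀ S : Set (ℝ × EuclideanSpace ℝ (Fin d) × ℝ), MeasurableSet S →
        μ (A ∩ {ω | (e n ω, c n ω, v n ω) ∈ S}) =
          ∫⁻ ω in A, eventLaw R (jumpChain R U f (c · ω) (v · ω) n) S ∂μ) ∧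
    ∀ᵐ ω ∂μ, ∀ n, ∀ t : ℝ≥0,
      jumpTime R U f (e · ω) (c · ω) (v · ω) n ≤ (t : ℝ≥0∞) →
      (t : ℝ≥0∞) < jumpTime R U f (e · ω) (c · ω) (v · ω) (n + 1) →
        X t ω = jumpChain R U f (c · ω) (v · ω) n

/-! ### Effect of one event on the support and on the jump rate -/

section Deterministic

variable {d : ℕ} {R U : ℝ} {c : EuclideanSpace ℝ (Fin d)} {v : ℝ}
  {g f : EuclideanSpace ℝ (Fin d) → ℝ}

/-! The support changes only when the parent is Red: a Blue parent multiplies the Red frequency by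
`1 - U ≠ 0` on a ball, so no point leaves the support. Everything therefore rests on showing that
almost surely only finitely many parents are Red.

Let `V` be the volume of a ball of radius `R`. The total Red mass is a nonnegative martingale along
the jump chain (`martingale_mass`): the expected gain and the expected loss are the same double
integral. Hence it converges almost surely. Its limit is zero (`ae_tendsto_mass_zero`): while the
mass is bounded away from zero, the next event changes it by at least `U V / 4` with probability at
least a constant divided by the jump rate (`exists_le_eventLaw_large_jump`). Each event adds at most
one ball of radius `2R` to the active centres, so the rate after `n` events is `O(n)`
(`jumpRate_jumpChain_le`) and these probabilities dominate a harmonic series. The conditional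
Borel–Cantelli lemma (`ae_frequently_of_tsum_condLaw_eq_top`) then yields infinitely many large
jumps, which contradicts convergence to a positive limit.

Once the mass is below `V / 2`, a Red parent would lift it to at least `U V / 2`; so eventually all
parents are Blue (`eventually_lt_of_tendsto_mass_zero`). From then on the support and the rate are
frozen. The event times tend to infinity, because infinitely many normalised holding times exceed
`1`. Each of finitely many balls of radius `R / 2` covering the support receives infinitely many
centres, and a round of such visits multiplies the uniform bound on the Red frequency by `1 - U`
(`exists_jumpChain_le_pow`). -/

lemma reproduce_of_mem {y : EuclideanSpace ℝ (Fin d)} (hy : y ∈ Metric.closedBall c R) :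
    reproduce R U c v g y = (1 - U) * g y + U * (if v ≤ g c then 1 else 0) := by
  rw [reproduce, Set.indicator_of_mem hy]
  simp only [Pi.one_apply]
  ring

lemma reproduce_of_notMem {y : EuclideanSpace ℝ (Fin d)} (hy : y ∉ Metric.closedBall c R) :
    reproduce R U c v g y = g y := by
  rw [reproduce, Set.indicator_of_notMem hy]
  ring

lemma reproduce_mem_Icc (hU0 : 0 < U) (hU1 : U < 1) (hg : ∀ y, g y ∈ Set.Icc (0 : ℝ) 1)
    (y : EuclideanSpace ℝ (Fin d)) : reproduce R U c v g y ∈ Set.Icc (0 : ℝ) 1 := by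
  by_cases hy : y ∈ Metric.closedBall c R
  · rw [reproduce_of_mem hy]
    obtain ⟨h0, h1⟩ := hg y
    split_ifs
    · constructor <;> nlinarith
    · constructor <;> nlinarith
  · rw [reproduce_of_notMem hy]
    exact hg y

lemma support_reproduce_of_le (hU0 : 0 < U) (hU1 : U < 1) (hg : ∀ y, g y ∈ Set.Icc (0 : ℝ) 1)
    (hv : v ≤ g c) :
    Function.support (reproduce R U c v g) = Function.support g ∪ Metric.closedBall c R := by
  ext y
  simp only [Set.mem_union, Function.mem_support]
  by_cases hy : y ∈ Metric.closedBall c R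
  · rw [reproduce_of_mem hy, if_pos hv]
    have := (hg y).1
    simp only [hy, or_true, iff_true]
    have : 0 ≤ (1 - U) * g y := mul_nonneg (by linarith) this
    linarith
  · rw [reproduce_of_notMem hy]
    simp [hy]

/-- A Blue parent only rescales the state by the nonzero factor `1 - U` on the ball; with `U = 1`
the ball would be cleared. -/
lemma support_reproduce_of_lt (hU1 : U < 1) (hv : g c < v) :
    Function.support (reproduce R U c v g) = Function.support g := by
  ext y
  simp only [Function.mem_support]
  by_cases hy : y ∈ Metric.closedBall c R
  · rw [reproduce_of_mem hy, if_neg hv.not_ge]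
    have : 1 - U ≠ 0 := by linarith
    simp [this]
  · rw [reproduce_of_notMem hy]

lemma activeCentres_reproduce_of_le (hR : 0 < R) (hU0 : 0 < U) (hU1 : U < 1)
    (hg : ∀ y, g y ∈ Set.Icc (0 : ℝ) 1) (hv : v ≤ g c) :
    activeCentres R (reproduce R U c v g) = activeCentres R g ∪ Metric.closedBall c (R + R) := by
  rw [activeCentres, tsupport, support_reproduce_of_le hU0 hU1 hg hv, closure_union,
    Metric.cthickening_union, Metric.isClosed_closedBall.closure_eq,
    cthickening_closedBall hR.le hR.le]
  rfl

lemma activeCentres_reproduce_of_lt (hU1 : U < 1) (hv : g c < v) :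
    activeCentres R (reproduce R U c v g) = activeCentres R g := by
  rw [activeCentres, tsupport, support_reproduce_of_lt hU1 hv]
  rfl

lemma isClosed_activeCentres : IsClosed (activeCentres R g) := Metric.isClosed_cthickening

lemma isBounded_activeCentres (hg : Bornology.IsBounded (Function.support g)) :
    Bornology.IsBounded (activeCentres R g) :=
  (Metric.isBounded_closure_of_isBounded hg).cthickening

lemma closedBall_subset_activeCentres {x : EuclideanSpace ℝ (Fin d)} (hx : x ∈ tsupport g) :
    Metric.closedBall x R ⊆ activeCentres R g :=
  Metric.closedBall_subset_cthickening hx R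

lemma jumpRate_ne_top (hg : Bornology.IsBounded (Function.support g)) : jumpRate R g ≠ ∞ :=
  (isBounded_activeCentres hg).measure_lt_top.ne

lemma jumpRate_ne_zero (hR : 0 < R) (hg : g ≠ 0) : jumpRate R g ≠ 0 := by
  obtain ⟨x, hx⟩ := Function.support_nonempty_iff.2 hg
  refine ((Metric.measure_closedBall_pos volume x hR).trans_le
    (measure_mono (closedBall_subset_activeCentres (subset_tsupport g hx)))).ne'

section Chain

variable {cs : ℕ → EuclideanSpace ℝ (Fin d)} {vs : ℕ → ℝ}

lemma jumpChain_mem_Icc (hU0 : 0 < U) (hU1 : U < 1) (hf : ∀ y, f y ∈ Set.Icc (0 : ℝ) 1) (n : ℕ)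
    (y : EuclideanSpace ℝ (Fin d)) : jumpChain R U f cs vs n y ∈ Set.Icc (0 : ℝ) 1 := by
  induction n generalizing y with
  | zero => exact hf y
  | succ n ih => exact reproduce_mem_Icc hU0 hU1 ih y

lemma support_jumpChain_subset_succ (hU0 : 0 < U) (hU1 : U < 1)
    (hf : ∀ y, f y ∈ Set.Icc (0 : ℝ) 1) (n : ℕ) :
    Function.support (jumpChain R U f cs vs n) ⊆
      Function.support (jumpChain R U f cs vs (n + 1)) := by
  rcases le_or_gt (vs n) (jumpChain R U f cs vs n (cs n)) with h | h
  · rw [jumpChain, support_reproduce_of_le hU0 hU1 (jumpChain_mem_Icc hU0 hU1 hf n) h]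
    exact Set.subset_union_left
  · rw [jumpChain, support_reproduce_of_lt hU1 h]

lemma support_jumpChain_mono (hU0 : 0 < U) (hU1 : U < 1) (hf : ∀ y, f y ∈ Set.Icc (0 : ℝ) 1) :
    Monotone fun n => Function.support (jumpChain R U f cs vs n) :=
  monotone_nat_of_le_succ (support_jumpChain_subset_succ hU0 hU1 hf)

lemma jumpChain_ne_zero (hU0 : 0 < U) (hU1 : U < 1) (hf : ∀ y, f y ∈ Set.Icc (0 : ℝ) 1)
    (hf0 : f ≠ 0) (n : ℕ) : jumpChain R U f cs vs n ≠ 0 := by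
  obtain ⟨x, hx⟩ := Function.support_nonempty_iff.2 hf0
  exact Function.support_nonempty_iff.1 ⟨x, support_jumpChain_mono hU0 hU1 hf n.zero_le hx⟩

lemma isBounded_support_jumpChain (hU0 : 0 < U) (hU1 : U < 1)
    (hf : ∀ y, f y ∈ Set.Icc (0 : ℝ) 1) (hfb : Bornology.IsBounded (Function.support f)) (n : ℕ) :
    Bornology.IsBounded (Function.support (jumpChain R U f cs vs n)) := by
  induction n with
  | zero => exact hfb
  | succ n ih =>
    rcases le_or_gt (vs n) (jumpChain R U f cs vs n (cs n)) with h | h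
    · rw [jumpChain, support_reproduce_of_le hU0 hU1 (jumpChain_mem_Icc hU0 hU1 hf n) h]
      exact ih.union Metric.isBounded_closedBall
    · rwa [jumpChain, support_reproduce_of_lt hU1 h]

/-- A Red parent adds one ball of radius `2R` to the active centres and a Blue one adds nothing.
Linear growth is just slow enough for the reciprocals of the rates to have a divergent sum. -/
lemma jumpRate_jumpChain_le (hR : 0 < R) (hU0 : 0 < U) (hU1 : U < 1)
    (hf : ∀ y, f y ∈ Set.Icc (0 : ℝ) 1) (n : ℕ) :
    jumpRate R (jumpChain R U f cs vs n) ≤ jumpRate R f +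
      n * volume (Metric.closedBall (0 : EuclideanSpace ℝ (Fin d)) (R + R)) := by
  induction n with
  | zero => simp [jumpChain]
  | succ n ih =>
    have key : jumpRate R (jumpChain R U f cs vs (n + 1)) ≤ jumpRate R (jumpChain R U f cs vs n) +
        volume (Metric.closedBall (0 : EuclideanSpace ℝ (Fin d)) (R + R)) := by
      rcases le_or_gt (vs n) (jumpChain R U f cs vs n (cs n)) with h | h
      · rw [jumpRate, jumpChain,
          activeCentres_reproduce_of_le hR hU0 hU1 (jumpChain_mem_Icc hU0 hU1 hf n) h]
        refine (measure_union_le _ _).trans_eq ?_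
        rw [Measure.addHaar_closedBall_center volume (cs n)]
        rfl
      · rw [jumpRate, jumpChain, activeCentres_reproduce_of_lt hU1 h]
        exact le_self_add
    refine key.trans ((add_le_add_left ih _).trans_eq ?_)
    push_cast
    ring

end Chain

end Deterministic

/-! ### Measurability of the chain, the rates and the event times -/

section Measurability

variable {d : ℕ} {R U : ℝ} {f : EuclideanSpace ℝ (Fin d) → ℝ} {Ω : Type*} [MeasurableSpace Ω]
  {c : ℕ → Ω → EuclideanSpace ℝ (Fin d)} {v : ℕ → Ω → ℝ}

lemma measurable_reproduce {c : Ω → EuclideanSpace ℝ (Fin d)} {v : Ω → ℝ}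
    {g : Ω → EuclideanSpace ℝ (Fin d) → ℝ} (hc : Measurable c) (hv : Measurable v)
    (hg : Measurable (Function.uncurry g)) :
    Measurable fun p : Ω × EuclideanSpace ℝ (Fin d) =>
      reproduce R U (c p.1) (v p.1) (g p.1) p.2 := by
  have h1 : Measurable fun p : Ω × EuclideanSpace ℝ (Fin d) =>
      (Metric.closedBall (c p.1) R).indicator (1 : EuclideanSpace ℝ (Fin d) → ℝ) p.2 := by
    have : MeasurableSet {p : Ω × EuclideanSpace ℝ (Fin d) | dist p.2 (c p.1) ≤ R} :=
      measurableSet_le (measurable_snd.dist (hc.comp measurable_fst)) measurable_const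
    exact (measurable_const (a := (1 : ℝ))).indicator this
  have h2 : Measurable fun p : Ω × EuclideanSpace ℝ (Fin d) =>
      if v p.1 ≤ g p.1 (c p.1) then (1 : ℝ) else 0 := by
    refine Measurable.ite (measurableSet_le (hv.comp measurable_fst) ?_) measurable_const
      measurable_const
    exact hg.comp (measurable_fst.prodMk (hc.comp measurable_fst))
  have h3 : Measurable fun p : Ω × EuclideanSpace ℝ (Fin d) => g p.1 p.2 := hg
  unfold reproduce
  exact h3.add ((measurable_const.mul h1).mul (h2.sub h3))

lemma measurable_jumpChain (hf : Measurable f) (n : ℕ) (hc : ∀ i < n, Measurable (c i))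
    (hv : ∀ i < n, Measurable (v i)) :
    Measurable (Function.uncurry fun ω => jumpChain R U f (c · ω) (v · ω) n) := by
  induction n with
  | zero => exact hf.comp measurable_snd
  | succ n ih =>
    exact measurable_reproduce (hc n n.lt_succ_self) (hv n n.lt_succ_self)
      (ih (fun i hi => hc i (hi.trans n.lt_succ_self)) fun i hi => hv i (hi.trans n.lt_succ_self))

lemma measurableSet_red (hf : Measurable f) (n : ℕ) (hc : ∀ i ≤ n, Measurable (c i))
    (hv : ∀ i ≤ n, Measurable (v i)) :
    MeasurableSet {ω | v n ω ≤ jumpChain R U f (c · ω) (v · ω) n (c n ω)} :=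
  measurableSet_le (hv n le_rfl) ((measurable_jumpChain hf n (fun i hi => hc i hi.le)
    fun i hi => hv i hi.le).comp (measurable_id.prodMk (hc n le_rfl)))

/-- The closed support of a random function is not obviously measurable. Here the active centres
obey a recursion, a union with a ball of radius `2R` whenever the parent is Red, which gives joint
measurability by induction. -/
lemma measurableSet_activeCentres_jumpChain (hR : 0 < R) (hU0 : 0 < U) (hU1 : U < 1)
    (hf : Measurable f) (hf1 : ∀ y, f y ∈ Set.Icc (0 : ℝ) 1) (n : ℕ)
    (hc : ∀ i < n, Measurable (c i)) (hv : ∀ i < n, Measurable (v i)) :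
    MeasurableSet {p : Ω × EuclideanSpace ℝ (Fin d) |
      p.2 ∈ activeCentres R (jumpChain R U f (c · p.1) (v · p.1) n)} := by
  induction n with
  | zero => exact measurable_snd isClosed_activeCentres.measurableSet
  | succ n ih =>
    have h1 := ih (fun i hi => hc i (hi.trans n.lt_succ_self))
      fun i hi => hv i (hi.trans n.lt_succ_self)
    have h2 : MeasurableSet {p : Ω × EuclideanSpace ℝ (Fin d) |
        v n p.1 ≤ jumpChain R U f (c · p.1) (v · p.1) n (c n p.1)} :=
      measurable_fst (measurableSet_red hf n (fun i hi => hc i (Nat.lt_succ_of_le hi))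
        fun i hi => hv i (Nat.lt_succ_of_le hi))
    have h3 : MeasurableSet {p : Ω × EuclideanSpace ℝ (Fin d) | dist p.2 (c n p.1) ≤ R + R} :=
      measurableSet_le (measurable_snd.dist ((hc n n.lt_succ_self).comp measurable_fst))
        measurable_const
    convert h1.union (h2.inter h3) using 1
    ext p
    rcases le_or_gt (v n p.1) (jumpChain R U f (c · p.1) (v · p.1) n (c n p.1)) with h | h
    · simp only [Set.mem_ofPred_eq, jumpChain, Set.mem_union, Set.mem_inter_iff, h, true_and]
      rw [activeCentres_reproduce_of_le hR hU0 hU1 (jumpChain_mem_Icc hU0 hU1 hf1 n) h]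
      rfl
    · simp only [Set.mem_ofPred_eq, jumpChain, Set.mem_union, Set.mem_inter_iff, h.not_ge,
        false_and, or_false]
      rw [activeCentres_reproduce_of_lt hU1 h]

lemma measurable_jumpRate_jumpChain (hR : 0 < R) (hU0 : 0 < U) (hU1 : U < 1)
    (hf : Measurable f) (hf1 : ∀ y, f y ∈ Set.Icc (0 : ℝ) 1) (n : ℕ)
    (hc : ∀ i < n, Measurable (c i)) (hv : ∀ i < n, Measurable (v i)) :
    Measurable fun ω => jumpRate R (jumpChain R U f (c · ω) (v · ω) n) :=
  measurable_measure_prodMk_left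
    (measurableSet_activeCentres_jumpChain hR hU0 hU1 hf hf1 n hc hv)

lemma measurable_jumpTime {e : ℕ → Ω → ℝ} (hR : 0 < R) (hU0 : 0 < U) (hU1 : U < 1)
    (hf : Measurable f) (hf1 : ∀ y, f y ∈ Set.Icc (0 : ℝ) 1) (he : ∀ i, Measurable (e i))
    (hc : ∀ i, Measurable (c i)) (hv : ∀ i, Measurable (v i)) (n : ℕ) :
    Measurable fun ω => jumpTime R U f (e · ω) (c · ω) (v · ω) n := by
  induction n with
  | zero => exact measurable_const
  | succ n ih =>
    exact ih.add ((he n).ennreal_ofReal.div (measurable_jumpRate_jumpChain hR hU0 hU1 hf hf1 n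
      (fun i _ => hc i) fun i _ => hv i))

end Measurability

/-! ### Conditional laws and the conditional Borel–Cantelli lemma -/

section ConditionalLaw

lemma measurable_measure_section {Ω 𝒵 : Type*} [MeasurableSpace Ω] [MeasurableSpace 𝒵]
    {κ : Ω → Measure 𝒵} [∀ ω, IsProbabilityMeasure (κ ω)]
    (hκ : ∀ S, MeasurableSet S → Measurable fun ω => κ ω S) {S : Set (Ω × 𝒵)}
    (hS : MeasurableSet S) : Measurable fun ω => κ ω {z | (ω, z) ∈ S} := by
  let K : Kernel Ω 𝒵 := ⟨κ, Measure.measurable_of_measurable_coe κ hκ⟩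
  have : IsMarkovKernel K := ⟨fun ω => inferInstanceAs (IsProbabilityMeasure (κ ω))⟩
  exact Kernel.measurable_kernel_prodMk_left (κ := K) hS

/-- If `κ` is the conditional law of `Z` given `P`, then the joint law of `P` and `Z` disintegrates
along `κ`. -/
lemma lintegral_eq_lintegral_condLaw {Ω Ω' 𝒵 : Type*} [MeasurableSpace Ω] [MeasurableSpace Ω']
    [MeasurableSpace 𝒵] (μ : Measure Ω) [IsFiniteMeasure μ] {P : Ω → Ω'} (hP : Measurable P)
    {Z : Ω → 𝒵} (hZ : Measurable Z) {κ : Ω' → Measure 𝒵} [∀ ω, IsProbabilityMeasure (κ ω)]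
    (hκ : ∀ S, MeasurableSet S → Measurable fun ω => κ ω S)
    (h : ∀ A, MeasurableSet A → ∀ S, MeasurableSet S →
      μ (P ⁻¹' A ∩ {ω | Z ω ∈ S}) = ∫⁻ ω in P ⁻¹' A, κ (P ω) S ∂μ)
    {H : Ω' × 𝒵 → ℝ≥0∞} (hH : Measurable H) :
    ∫⁻ ω, H (P ω, Z ω) ∂μ = ∫⁻ ω, ∫⁻ z, H (P ω, z) ∂(κ (P ω)) ∂μ := by
  let K : Kernel Ω' 𝒵 := ⟨κ, Measure.measurable_of_measurable_coe κ hκ⟩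
  have : IsMarkovKernel K := ⟨fun ω => inferInstanceAs (IsProbabilityMeasure (κ ω))⟩
  -- Finite measures on a product are determined by rectangles, and on rectangles the equality is
  -- the hypothesis `h`.
  have hmap : μ.map (fun ω => (P ω, Z ω)) = (μ.map P) ⊗ₘ K := by
    refine Measure.ext_prod fun {s t} hs ht => ?_
    rw [Measure.map_apply (hP.prodMk hZ) (hs.prod ht), Measure.compProd_apply_prod hs ht,
      setLIntegral_map hs (K.measurable_coe ht) hP]
    exact h s hs t ht
  rw [← lintegral_map hH (hP.prodMk hZ), hmap, Measure.lintegral_compProd hH,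
    lintegral_map (hH.lintegral_kernel_prod_right') hP]
  rfl

/-- `lintegral_eq_lintegral_condLaw`, for the conditional law given a sub-σ-algebra. -/
lemma lintegral_eq_lintegral_condLaw_of_le {Ω 𝒵 : Type*} {m mΩ : MeasurableSpace Ω}
    [MeasurableSpace 𝒵] (hm : m ≤ mΩ) (μ : Measure Ω) [IsFiniteMeasure μ]
    {Z : Ω → 𝒵} (hZ : Measurable Z) {κ : Ω → Measure 𝒵} [∀ ω, IsProbabilityMeasure (κ ω)]
    (hκ : ∀ S, MeasurableSet S → Measurable[m] fun ω => κ ω S)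
    (h : ∀ A, MeasurableSet[m] A → ∀ S, MeasurableSet S →
      μ (A ∩ {ω | Z ω ∈ S}) = ∫⁻ ω in A, κ ω S ∂μ)
    {H : Ω × 𝒵 → ℝ≥0∞} (hH : Measurable[m.prod ‹_›] H) :
    ∫⁻ ω, H (ω, Z ω) ∂μ = ∫⁻ ω, ∫⁻ z, H (ω, z) ∂(κ ω) ∂μ :=
  -- The conditioning variable is the identity, whose target carries the smaller σ-algebra `m`.
  @lintegral_eq_lintegral_condLaw Ω Ω 𝒵 mΩ m _ μ _ id (measurable_id'' hm) Z hZ κ _ hκ h H hH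

variable {Ω 𝒵 : Type*} {mΩ : MeasurableSpace Ω} [MeasurableSpace 𝒵]

/-- The conditional Borel-Cantelli lemma, for events described by conditional laws. -/
lemma ae_frequently_of_tsum_condLaw_eq_top {𝓕 : Filtration ℕ mΩ} (μ : Measure Ω)
    [IsFiniteMeasure μ] {Z : ℕ → Ω → 𝒵} (hZ : ∀ n, Measurable[𝓕 (n + 1)] (Z n))
    {κ : ℕ → Ω → Measure 𝒵} [∀ n ω, IsProbabilityMeasure (κ n ω)]
    (hκ : ∀ n S, MeasurableSet S → Measurable[𝓕 n] fun ω => κ n ω S)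
    (h : ∀ n A, MeasurableSet[𝓕 n] A → ∀ S, MeasurableSet S →
      μ (A ∩ {ω | Z n ω ∈ S}) = ∫⁻ ω in A, κ n ω S ∂μ)
    {S : ℕ → Set (Ω × 𝒵)} (hS : ∀ n, MeasurableSet[(𝓕 n).prod ‹_›] (S n)) :
    ∀ᵐ ω ∂μ, ∑' n, κ n ω {z | (ω, z) ∈ S n} = ∞ → ∃ᶠ n in atTop, (ω, Z n ω) ∈ S n := by
  -- The index is shifted by one because `Z k` is known only at time `k + 1`; this makes `s`
  -- adapted, as Lévy's extension of Borel–Cantelli requires.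
  let s : ℕ → Set Ω := fun n => Nat.casesOn n ∅ fun k => {ω | (ω, Z k ω) ∈ S k}
  have hs : ∀ n, MeasurableSet[𝓕 n] (s n) := by
    rintro (_ | n)
    · exact @MeasurableSet.empty _ (𝓕 0)
    · have hpair : Measurable[𝓕 (n + 1), (𝓕 n).prod ‹_›] fun ω => (ω, Z n ω) :=
        @Measurable.prodMk _ (𝓕 (n + 1)) _ _ (𝓕 n) _ _ _
          (measurable_id'' (𝓕.mono n.le_succ)) (hZ n)
      exact hpair (hS n)
  have hp : ∀ n, Measurable[𝓕 n] fun ω => κ n ω {z | (ω, z) ∈ S n} := fun n =>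
    @measurable_measure_section _ _ (𝓕 n) _ _ _ (hκ n) _ (hS n)
  have hset : ∀ n A, MeasurableSet[𝓕 n] A →
      ∫⁻ ω in A, κ n ω {z | (ω, z) ∈ S n} ∂μ = μ (A ∩ s (n + 1)) := by
    intro n A hA
    have hA' : MeasurableSet A := 𝓕.le n A hA
    have hAS : MeasurableSet[(𝓕 n).prod ‹_›] (S n ∩ Prod.fst ⁻¹' A) :=
      @MeasurableSet.inter _ ((𝓕 n).prod ‹_›) _ _ (hS n) (@measurable_fst _ _ (𝓕 n) _ _ hA)
    have := lintegral_eq_lintegral_condLaw_of_le (𝓕.le n) μ ((hZ n).mono (𝓕.le _) le_rfl) (hκ n) (h n)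
      (H := (S n ∩ Prod.fst ⁻¹' A).indicator 1)
      (Measurable.indicator (@measurable_one _ _ _ ((𝓕 n).prod ‹_›) _) hAS)
    rw [← lintegral_indicator hA']
    have hl : ∫⁻ ω, (S n ∩ Prod.fst ⁻¹' A).indicator (1 : Ω × 𝒵 → ℝ≥0∞) (ω, Z n ω) ∂μ =
        μ (A ∩ s (n + 1)) := by
      rw [← lintegral_indicator_one (hA'.inter (𝓕.le _ _ (hs (n + 1))))]
      refine lintegral_congr fun ω => ?_
      by_cases h1 : ω ∈ A ∩ s (n + 1)
      · rw [Set.indicator_of_mem h1, Set.indicator_of_mem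
          (show (ω, Z n ω) ∈ S n ∩ Prod.fst ⁻¹' A from ⟨h1.2, h1.1⟩)]
        rfl
      · rw [Set.indicator_of_notMem h1, Set.indicator_of_notMem
          (show (ω, Z n ω) ∉ S n ∩ Prod.fst ⁻¹' A from fun h2 => h1 ⟨h2.2, h2.1⟩)]
    rw [← hl, this]
    refine lintegral_congr fun ω => ?_
    by_cases hω : ω ∈ A
    · rw [Set.indicator_of_mem hω]
      have hsec : MeasurableSet {z | (ω, z) ∈ S n} :=
        @measurable_prodMk_left _ _ (𝓕 n) _ ω _ (hS n)
      rw [← lintegral_indicator_one hsec]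
      refine lintegral_congr fun z => ?_
      by_cases h1 : (ω, z) ∈ S n
      · rw [Set.indicator_of_mem (show z ∈ {z | (ω, z) ∈ S n} from h1), Set.indicator_of_mem
          (show (ω, z) ∈ S n ∩ Prod.fst ⁻¹' A from ⟨h1, hω⟩)]
        rfl
      · rw [Set.indicator_of_notMem (show z ∉ {z | (ω, z) ∈ S n} from h1), Set.indicator_of_notMem
          (show (ω, z) ∉ S n ∩ Prod.fst ⁻¹' A from fun h2 => h1 h2.1)]
    · rw [Set.indicator_of_notMem hω]
      refine (lintegral_eq_zero_of_ae_eq_zero (ae_of_all _ fun z => Set.indicator_of_notMem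
        (show (ω, z) ∉ S n ∩ Prod.fst ⁻¹' A from fun h2 => hω h2.2) _)).symm
  -- The section probability is `𝓕 n`-measurable and, by `hset`, has the right integral over every
  -- `𝓕 n`-set, so it is the conditional probability of `s (n + 1)`.
  have hcond : ∀ n, (fun ω => (κ n ω {z | (ω, z) ∈ S n}).toReal) =ᵐ[μ]
      μ[(s (n + 1)).indicator 1 | 𝓕 n] := by
    intro n
    have hs' : MeasurableSet (s (n + 1)) := 𝓕.le _ _ (hs (n + 1))
    have hpm := (hp n).mono (𝓕.le n) le_rfl
    refine ae_eq_condExp_of_forall_setIntegral_eq (𝓕.le n)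
      ((integrable_const (1 : ℝ)).indicator hs') ?_ ?_ ?_
    · intro A _ _
      refine Integrable.integrableOn (Integrable.of_bound hpm.ennreal_toReal.aestronglyMeasurable 1
        (ae_of_all _ fun ω => ?_))
      rw [Real.norm_of_nonneg ENNReal.toReal_nonneg]
      exact ENNReal.toReal_le_of_le_ofReal zero_le_one (by simpa using prob_le_one)
    · intro A hA _
      rw [integral_toReal hpm.aemeasurable (ae_of_all _ fun ω => measure_lt_top _ _),
        hset n A hA, integral_indicator_one hs', measureReal_restrict_apply hs', measureReal_def,
        Set.inter_comm]
    · exact (hp n).ennreal_toReal.stronglyMeasurable.aestronglyMeasurable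
  filter_upwards [ae_mem_limsup_atTop_iff μ hs, ae_all_iff.2 hcond] with ω hω hc hsum
  have hfreq : ∃ᶠ n in atTop, ω ∈ s n := by
    rw [← mem_limsup_iff_frequently_mem, hω]
    simp only [← hc]
    rw [← not_summable_iff_tendsto_nat_atTop_of_nonneg fun n => ENNReal.toReal_nonneg]
    intro hsm
    refine hsm.tsum_ofReal_ne_top ?_
    rw [← hsum]
    exact tsum_congr fun n => ENNReal.ofReal_toReal (measure_ne_top _ _)
  rw [frequently_atTop] at hfreq ⊢
  intro N
  obtain ⟨n, hn, hmem⟩ := hfreq (N + 1)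
  obtain ⟨k, rfl⟩ : ∃ k, n = k + 1 := ⟨n - 1, by omega⟩
  exact ⟨k, by omega, hmem⟩

end ConditionalLaw

/-! ### Red mass and its conservation in mean -/

section Mass

variable {d : ℕ} {R U : ℝ} {c : EuclideanSpace ℝ (Fin d)} {v : ℝ}
  {g f : EuclideanSpace ℝ (Fin d) → ℝ}

/-- The total mass of the Red type in the state `g`. -/
noncomputable def mass (g : EuclideanSpace ℝ (Fin d) → ℝ) : ℝ≥0∞ :=
  ∫⁻ y, ENNReal.ofReal (g y)

/-- The mass of the Red type in the closed ball of radius `R` around `c`. -/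
noncomputable def localMass (R : ℝ) (g : EuclideanSpace ℝ (Fin d) → ℝ)
    (c : EuclideanSpace ℝ (Fin d)) : ℝ≥0∞ :=
  ∫⁻ y in Metric.closedBall c R, ENNReal.ofReal (g y)

lemma isProbabilityMeasure_eventLaw (hR : 0 < R) (hg0 : g ≠ 0)
    (hgb : Bornology.IsBounded (Function.support g)) : IsProbabilityMeasure (eventLaw R g) := by
  have h1 : IsProbabilityMeasure (centreLaw R g) := by
    rw [centreLaw, if_neg hg0]
    exact cond_isProbabilityMeasure_of_finite (jumpRate_ne_zero hR hg0) (jumpRate_ne_top hgb)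
  have h2 : IsProbabilityMeasure (volume.restrict (Set.Icc (0 : ℝ) 1)) := ⟨by simp⟩
  have h3 := isProbabilityMeasure_expMeasure one_pos
  unfold eventLaw
  infer_instance

lemma lintegral_eventLaw_of_snd (hg0 : g ≠ 0) {F : EuclideanSpace ℝ (Fin d) × ℝ → ℝ≥0∞}
    (hF : Measurable F) :
    ∫⁻ z, F z.2 ∂(eventLaw R g) = (jumpRate R g)⁻¹ * ∫⁻ c in activeCentres R g,
      ∫⁻ v in Set.Icc (0 : ℝ) 1, F (c, v) := by
  have h3 := isProbabilityMeasure_expMeasure one_pos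
  have h4 : ∫⁻ z, F z.2 ∂(eventLaw R g) = ∫⁻ p, F p ∂((eventLaw R g).map Prod.snd) :=
    (lintegral_map hF measurable_snd).symm
  have h5 : SFinite (centreLaw R g) := by
    rw [centreLaw, if_neg hg0, ProbabilityTheory.cond]
    infer_instance
  rw [h4, eventLaw, Measure.map_snd_prod, measure_univ, one_smul, centreLaw, if_neg hg0,
    ProbabilityTheory.cond, ← jumpRate, Measure.prod_smul_left, lintegral_smul_measure, smul_eq_mul,
    lintegral_prod _ hF.aemeasurable]

lemma measurable_localMass (hg : Measurable g) : Measurable (localMass R g) := by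
  have h : MeasurableSet {p : EuclideanSpace ℝ (Fin d) × EuclideanSpace ℝ (Fin d) |
      dist p.2 p.1 ≤ R} := measurableSet_le (measurable_snd.dist measurable_fst) measurable_const
  have h2 : Measurable fun c => ∫⁻ y, {p : EuclideanSpace ℝ (Fin d) × EuclideanSpace ℝ (Fin d) |
      dist p.2 p.1 ≤ R}.indicator (fun p => ENNReal.ofReal (g p.2)) (c, y) :=
    ((hg.comp measurable_snd).ennreal_ofReal.indicator h).lintegral_prod_right'
  convert h2 using 2 with c
  rw [localMass, ← lintegral_indicator measurableSet_closedBall]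
  rfl

lemma measurable_mass_reproduce (hg : Measurable g) :
    Measurable fun p : EuclideanSpace ℝ (Fin d) × ℝ => mass (reproduce R U p.1 p.2 g) :=
  (measurable_reproduce (g := fun _ => g) measurable_fst measurable_snd
    (hg.comp measurable_snd)).ennreal_ofReal.lintegral_prod_right'

/-- A reproduction event adds the offspring, if they are Red, and removes a proportion `U` of the
Red individuals in the ball. -/
lemma mass_reproduce_add (hU0 : 0 < U) (hU1 : U < 1) (hgm : Measurable g)
    (hg : ∀ y, g y ∈ Set.Icc (0 : ℝ) 1) :
    mass (reproduce R U c v g) + ENNReal.ofReal U * localMass R g c =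
      mass g + (if v ≤ g c then ENNReal.ofReal U *
        volume (Metric.closedBall (0 : EuclideanSpace ℝ (Fin d)) R) else 0) := by
  have hpt : ∀ y, ENNReal.ofReal (reproduce R U c v g y) +
      (Metric.closedBall c R).indicator (fun y => ENNReal.ofReal U * ENNReal.ofReal (g y)) y =
      ENNReal.ofReal (g y) + (Metric.closedBall c R).indicator
        (fun _ => if v ≤ g c then ENNReal.ofReal U else 0) y := by
    intro y
    have h0 := (hg y).1
    by_cases hy : y ∈ Metric.closedBall c R
    · rw [reproduce_of_mem hy, Set.indicator_of_mem hy, Set.indicator_of_mem hy,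
        ← ENNReal.ofReal_mul hU0.le]
      have h1 : 0 ≤ (1 - U) * g y := mul_nonneg (by linarith) h0
      split_ifs
      · rw [← ENNReal.ofReal_add (by linarith) (by positivity), ← ENNReal.ofReal_add h0 hU0.le]
        congr 1
        ring
      · rw [← ENNReal.ofReal_add (by linarith) (by positivity), add_zero]
        congr 1
        ring
    · rw [reproduce_of_notMem hy, Set.indicator_of_notMem hy, Set.indicator_of_notMem hy]
  have hint := lintegral_congr (μ := volume) hpt
  rw [lintegral_add_right _ ((hgm.ennreal_ofReal.const_mul _).indicator measurableSet_closedBall),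
    lintegral_add_right _ (measurable_const.indicator measurableSet_closedBall),
    lintegral_indicator measurableSet_closedBall, lintegral_indicator measurableSet_closedBall,
    lintegral_const_mul _ hgm.ennreal_ofReal, setLIntegral_const,
    Measure.addHaar_closedBall_center volume c R] at hint
  rw [mass, mass, localMass, hint]
  split_ifs <;> simp

lemma setLIntegral_activeCentres (hR : 0 < R) (F : EuclideanSpace ℝ (Fin d) → ℝ≥0∞)
    (hF : ∀ y, g y = 0 → F y = 0) :
    ∫⁻ y in activeCentres R g, F y = ∫⁻ y, F y := by
  rw [← lintegral_indicator isClosed_activeCentres.measurableSet]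
  refine lintegral_congr fun y => ?_
  by_cases hy : y ∈ activeCentres R g
  · rw [Set.indicator_of_mem hy]
  · rw [Set.indicator_of_notMem hy, hF]
    by_contra h
    exact hy (closedBall_subset_activeCentres (subset_tsupport g h)
      (Metric.mem_closedBall_self hR.le))

/-- By Tonelli, each `y` is counted by the centres within `R` of it. If `g y ≠ 0` all of these are
active, so restricting to active centres loses nothing. -/
lemma setLIntegral_localMass (hgm : Measurable g) :
    ∫⁻ c in activeCentres R g, localMass R g c =
      volume (Metric.closedBall (0 : EuclideanSpace ℝ (Fin d)) R) * mass g := by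
  have hm : MeasurableSet {p : EuclideanSpace ℝ (Fin d) × EuclideanSpace ℝ (Fin d) |
      dist p.2 p.1 ≤ R} := measurableSet_le (measurable_snd.dist measurable_fst) measurable_const
  have h1 : ∀ c, localMass R g c = ∫⁻ y, {p : EuclideanSpace ℝ (Fin d) × EuclideanSpace ℝ (Fin d) |
      dist p.2 p.1 ≤ R}.indicator (fun p => ENNReal.ofReal (g p.2)) (c, y) := by
    intro c
    rw [localMass, ← lintegral_indicator measurableSet_closedBall]
    rfl
  simp only [h1]
  rw [lintegral_lintegral_swap (by
      exact ((hgm.comp measurable_snd).ennreal_ofReal.indicator hm).aemeasurable), mass,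
    ← lintegral_const_mul _ hgm.ennreal_ofReal]
  refine lintegral_congr fun y => ?_
  have h2 : ∀ c, {p : EuclideanSpace ℝ (Fin d) × EuclideanSpace ℝ (Fin d) |
      dist p.2 p.1 ≤ R}.indicator (fun p => ENNReal.ofReal (g p.2)) (c, y) =
      (Metric.closedBall y R).indicator (fun _ => ENNReal.ofReal (g y)) c := by
    intro c
    by_cases h : dist y c ≤ R
    · rw [Set.indicator_of_mem (show (c, y) ∈ {p : EuclideanSpace ℝ (Fin d) ×
        EuclideanSpace ℝ (Fin d) | dist p.2 p.1 ≤ R} from h), Set.indicator_of_mem]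
      rwa [Metric.mem_closedBall, dist_comm]
    · rw [Set.indicator_of_notMem (show (c, y) ∉ {p : EuclideanSpace ℝ (Fin d) ×
        EuclideanSpace ℝ (Fin d) | dist p.2 p.1 ≤ R} from h), Set.indicator_of_notMem]
      rwa [Metric.mem_closedBall, dist_comm]
  simp only [h2]
  rw [lintegral_indicator measurableSet_closedBall, setLIntegral_const, mul_comm]
  rcases eq_or_ne (g y) 0 with h | h
  · simp [h]
  · rw [Measure.restrict_apply measurableSet_closedBall, Set.inter_eq_left.2
      (closedBall_subset_activeCentres (subset_tsupport g h)),
      Measure.addHaar_closedBall_center volume y R]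

lemma setLIntegral_ite_le {a : ℝ} (ha : a ∈ Set.Icc (0 : ℝ) 1) (k : ℝ≥0∞) :
    ∫⁻ v in Set.Icc (0 : ℝ) 1, (if v ≤ a then k else 0) = k * ENNReal.ofReal a := by
  have : (fun v : ℝ => if v ≤ a then k else 0) = (Set.Iic a).indicator fun _ => k := by
    ext v
    rfl
  rw [this, lintegral_indicator measurableSet_Iic, setLIntegral_const,
    Measure.restrict_apply measurableSet_Iic, show Set.Iic a ∩ Set.Icc 0 1 = Set.Icc 0 a by
      ext v
      simp only [Set.mem_inter_iff, Set.mem_Iic, Set.mem_Icc]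
      exact ⟨fun h => ⟨h.2.1, h.1⟩, fun h => ⟨h.2, h.1, h.2.trans ha.2⟩⟩, Real.volume_Icc, sub_zero]

/-- A centre `c` gives mean gain `U V g(c)`, where `V` is the volume of the ball, and loss `U` times
the local mass at `c`. Integrated over the active centres, both equal `U V` times the mass. The
balance is kept additive, and the common term, being finite, is cancelled at the end. -/
lemma lintegral_mass_reproduce (hR : 0 < R) (hU0 : 0 < U) (hU1 : U < 1) (hgm : Measurable g)
    (hg : ∀ y, g y ∈ Set.Icc (0 : ℝ) 1) (hg0 : g ≠ 0)
    (hgb : Bornology.IsBounded (Function.support g)) (hmass : mass g ≠ ∞) :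
    ∫⁻ z, mass (reproduce R U z.2.1 z.2.2 g) ∂(eventLaw R g) = mass g := by
  have := isProbabilityMeasure_eventLaw hR hg0 hgb
  have hint := lintegral_congr (μ := eventLaw R g) fun z =>
    mass_reproduce_add (R := R) (c := z.2.1) (v := z.2.2) hU0 hU1 hgm hg
  have hm1 : Measurable fun p : EuclideanSpace ℝ (Fin d) × ℝ =>
      ENNReal.ofReal U * localMass R g p.1 :=
    ((measurable_localMass hgm).comp measurable_fst).const_mul _
  have hm2 : Measurable fun p : EuclideanSpace ℝ (Fin d) × ℝ =>
      if p.2 ≤ g p.1 then ENNReal.ofReal U *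
        volume (Metric.closedBall (0 : EuclideanSpace ℝ (Fin d)) R) else 0 :=
    Measurable.ite (measurableSet_le measurable_snd (hgm.comp measurable_fst)) measurable_const
      measurable_const
  have hm1' : Measurable fun z : ℝ × EuclideanSpace ℝ (Fin d) × ℝ =>
      ENNReal.ofReal U * localMass R g z.2.1 := hm1.comp measurable_snd
  have hm2' : Measurable fun z : ℝ × EuclideanSpace ℝ (Fin d) × ℝ =>
      if z.2.2 ≤ g z.2.1 then ENNReal.ofReal U *
        volume (Metric.closedBall (0 : EuclideanSpace ℝ (Fin d)) R) else 0 :=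
    hm2.comp measurable_snd
  rw [lintegral_add_right _ hm1', lintegral_add_right _ hm2', lintegral_const, measure_univ,
    mul_one, lintegral_eventLaw_of_snd hg0 hm1, lintegral_eventLaw_of_snd hg0 hm2] at hint
  simp only [setLIntegral_ite_le (hg _), lintegral_const, Measure.restrict_apply_univ,
    Real.volume_Icc, sub_zero, ENNReal.ofReal_one, mul_one] at hint
  rw [lintegral_const_mul _ (measurable_localMass hgm), lintegral_const_mul _ hgm.ennreal_ofReal,
    setLIntegral_localMass hgm, setLIntegral_activeCentres hR _ (fun y hy => by simp [hy]),
    ← mass, mul_assoc] at hint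
  refine (ENNReal.add_left_inj ?_).1 hint
  refine ENNReal.mul_ne_top (ENNReal.inv_ne_top.2 (jumpRate_ne_zero hR hg0))
    (ENNReal.mul_ne_top ENNReal.ofReal_ne_top (ENNReal.mul_ne_top ?_ hmass))
  exact measure_closedBall_lt_top.ne

lemma mass_le_jumpRate (hR : 0 < R) (hg : ∀ y, g y ∈ Set.Icc (0 : ℝ) 1) :
    mass g ≤ jumpRate R g := by
  rw [mass, ← setLIntegral_activeCentres (g := g) hR _ (fun y hy => by simp [hy]), jumpRate,
    ← setLIntegral_one]
  exact lintegral_mono fun y => ENNReal.ofReal_le_one.2 (hg y).2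

end Mass

/-! ### Lower bound for the probability of a large jump of the mass -/

section JumpSize

variable {d : ℕ} {R U : ℝ} {c c' : EuclideanSpace ℝ (Fin d)} {v : ℝ}
  {g f : EuclideanSpace ℝ (Fin d) → ℝ}

/-- The volume of a closed ball of radius `r` in `ℝ^d`. -/
noncomputable def ballVolume (d : ℕ) (r : ℝ) : ℝ :=
  volume.real (Metric.closedBall (0 : EuclideanSpace ℝ (Fin d)) r)

lemma volume_real_closedBall (c : EuclideanSpace ℝ (Fin d)) (r : ℝ) :
    volume.real (Metric.closedBall c r) = ballVolume d r := by
  rw [ballVolume, measureReal_def, measureReal_def, Measure.addHaar_closedBall_center]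

lemma ofReal_ballVolume (c : EuclideanSpace ℝ (Fin d)) (r : ℝ) :
    ENNReal.ofReal (ballVolume d r) = volume (Metric.closedBall c r) := by
  rw [← volume_real_closedBall c, measureReal_def,
    ENNReal.ofReal_toReal measure_closedBall_lt_top.ne]

lemma ballVolume_pos {r : ℝ} (hr : 0 < r) : 0 < ballVolume d r :=
  ENNReal.toReal_pos (Metric.measure_closedBall_pos volume _ hr).ne' measure_closedBall_lt_top.ne

lemma tendsto_ballVolume_add {r : ℝ} (hr : 0 ≤ r) :
    Tendsto (fun δ => ballVolume d (r + δ) - ballVolume d r) (𝓝[≥] 0) (𝓝 0) := by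
  have h : ∀ s, 0 ≤ s → ballVolume d s =
      s ^ Module.finrank ℝ (EuclideanSpace ℝ (Fin d)) *
        volume.real (Metric.ball (0 : EuclideanSpace ℝ (Fin d)) 1) :=
    fun s hs => Measure.addHaar_real_closedBall volume _ hs
  have h2 : Tendsto (fun δ : ℝ => (r + δ) ^ Module.finrank ℝ (EuclideanSpace ℝ (Fin d)) *
      volume.real (Metric.ball (0 : EuclideanSpace ℝ (Fin d)) 1) - ballVolume d r)
      (𝓝[≥] 0) (𝓝 0) := by
    refine (Continuous.tendsto' (by fun_prop) 0 0 ?_).mono_left nhdsWithin_le_nhds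
    rw [h r hr, add_zero, sub_self]
  refine h2.congr' ?_
  filter_upwards [self_mem_nhdsWithin] with δ hδ
  rw [h (r + δ) (add_nonneg hr hδ)]

lemma setLIntegral_ofReal_le (hg : ∀ y, g y ∈ Set.Icc (0 : ℝ) 1)
    (s : Set (EuclideanSpace ℝ (Fin d))) : ∫⁻ y in s, ENNReal.ofReal (g y) ≤ volume s := by
  rw [← setLIntegral_one]
  exact lintegral_mono fun y => ENNReal.ofReal_le_one.2 (hg y).2

lemma localMass_ne_top (hg : ∀ y, g y ∈ Set.Icc (0 : ℝ) 1) : localMass R g c ≠ ∞ :=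
  ((setLIntegral_ofReal_le hg _).trans_lt measure_closedBall_lt_top).ne

/-- The ball around `c` lies in the ball around `c'` enlarged by `δ`, and since `g ≤ 1` the extra
shell contributes at most its volume. The modulus of continuity so obtained does not depend on `g`.
-/
lemma localMass_le (hg : ∀ y, g y ∈ Set.Icc (0 : ℝ) 1) {δ : ℝ} (hδ : 0 ≤ δ)
    (h : dist c c' ≤ δ) :
    (localMass R g c).toReal ≤
      (localMass R g c').toReal + (ballVolume d (R + δ) - ballVolume d R) := by
  have hsub : Metric.closedBall c' R ⊆ Metric.closedBall c' (R + δ) :=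
    Metric.closedBall_subset_closedBall (by linarith)
  have hdiff : volume.real (Metric.closedBall c' (R + δ) \ Metric.closedBall c' R) =
      ballVolume d (R + δ) - ballVolume d R := by
    rw [measureReal_sdiff hsub measurableSet_closedBall
      measure_closedBall_lt_top.ne, volume_real_closedBall,
      volume_real_closedBall]
  rw [← hdiff, measureReal_def, ← ENNReal.toReal_add (localMass_ne_top hg)
    (measure_ne_top_of_subset Set.sdiff_subset measure_closedBall_lt_top.ne)]
  refine ENNReal.toReal_mono (ENNReal.add_ne_top.2 ⟨localMass_ne_top hg,
    measure_ne_top_of_subset Set.sdiff_subset measure_closedBall_lt_top.ne⟩) ?_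
  calc localMass R g c ≤ ∫⁻ y in Metric.closedBall c' (R + δ), ENNReal.ofReal (g y) :=
        lintegral_mono_set (Metric.closedBall_subset_closedBall' (by linarith))
    _ ≤ localMass R g c' + ∫⁻ y in Metric.closedBall c' (R + δ) \ Metric.closedBall c' R,
          ENNReal.ofReal (g y) := by
        rw [localMass]
        refine (lintegral_mono_set ?_).trans (lintegral_union_le _ _ _)
        rw [Set.union_sdiff_cancel hsub]
    _ ≤ _ := by gcongr; exact setLIntegral_ofReal_le hg _

lemma continuous_localMass (hg : ∀ y, g y ∈ Set.Icc (0 : ℝ) 1) (hR : 0 ≤ R) :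
    Continuous fun c => (localMass R g c).toReal := by
  rw [continuous_iff_continuousAt]
  intro c
  rw [ContinuousAt, tendsto_iff_dist_tendsto_zero]
  have h1 : Tendsto (fun c' => dist c' c) (𝓝 c) (𝓝[≥] 0) :=
    tendsto_nhdsWithin_iff.2 ⟨Continuous.tendsto' (by fun_prop) c 0 (dist_self c),
      Eventually.of_forall fun _ => dist_nonneg⟩
  refine squeeze_zero (fun _ => dist_nonneg) (fun c' => ?_)
    ((tendsto_ballVolume_add (d := d) hR).comp h1)
  rw [Real.dist_eq, abs_le]
  have h2 := localMass_le (R := R) (c := c) (c' := c') hg dist_nonneg (dist_comm c c').le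
  have h3 := localMass_le (R := R) (c := c') (c' := c) hg dist_nonneg le_rfl
  simp only [Function.comp_apply]
  constructor <;> linarith

lemma mem_activeCentres_of_localMass_pos (h : 0 < (localMass R g c).toReal) :
    c ∈ activeCentres R g := by
  by_contra hc
  have : localMass R g c = 0 := by
    refine (setLIntegral_congr_fun measurableSet_closedBall fun y hy => ?_).trans lintegral_zero
    by_contra hy0
    refine hc (closedBall_subset_activeCentres (subset_tsupport g ?_)
      (Metric.mem_closedBall'.2 hy))
    intro h0
    simp [h0] at hy0
  simp [this] at h

lemma mass_reproduce_sub (hU0 : 0 < U) (hU1 : U < 1) (hgm : Measurable g)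
    (hg : ∀ y, g y ∈ Set.Icc (0 : ℝ) 1) (hmass : mass g ≠ ∞) :
    (mass (reproduce R U c v g)).toReal - (mass g).toReal =
      U * ((if v ≤ g c then ballVolume d R else 0) - (localMass R g c).toReal) := by
  have h := mass_reproduce_add (R := R) (c := c) (v := v) hU0 hU1 hgm hg
  have h1 : (if v ≤ g c then ENNReal.ofReal U *
      volume (Metric.closedBall (0 : EuclideanSpace ℝ (Fin d)) R) else 0) =
      ENNReal.ofReal (U * if v ≤ g c then ballVolume d R else 0) := by
    split_ifs
    · rw [ENNReal.ofReal_mul hU0.le, ofReal_ballVolume]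
    · simp
  have h0 : 0 ≤ U * if v ≤ g c then ballVolume d R else 0 := by
    split_ifs
    · exact mul_nonneg hU0.le measureReal_nonneg
    · simp
  rw [h1] at h
  have hfin : mass (reproduce R U c v g) ≠ ∞ := by
    have : mass (reproduce R U c v g) + ENNReal.ofReal U * localMass R g c ≠ ∞ := by
      rw [h]
      exact ENNReal.add_ne_top.2 ⟨hmass, ENNReal.ofReal_ne_top⟩
    exact (ENNReal.add_ne_top.1 this).1
  have h2 := congrArg ENNReal.toReal h
  rw [ENNReal.toReal_add hfin (ENNReal.mul_ne_top ENNReal.ofReal_ne_top (localMass_ne_top hg)),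
    ENNReal.toReal_add hmass ENNReal.ofReal_ne_top, ENNReal.toReal_mul,
    ENNReal.toReal_ofReal hU0.le, ENNReal.toReal_ofReal h0] at h2
  linarith

/-- The probability of a significant change of the mass is bounded below in terms of the mass. -/
lemma exists_le_eventLaw_large_jump (hd : 1 ≤ d) (hR : 0 < R) (hU0 : 0 < U) (hU1 : U < 1) :
    ∃ ρ > 0, ∀ g : EuclideanSpace ℝ (Fin d) → ℝ, Measurable g →
      (∀ y, g y ∈ Set.Icc (0 : ℝ) 1) → g ≠ 0 → Bornology.IsBounded (Function.support g) →
      min (mass g) (ENNReal.ofReal ρ) / jumpRate R g ≤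
        eventLaw R g {z | U * ballVolume d R / 4 ≤
          |(mass (reproduce R U z.2.1 z.2.2 g)).toReal - (mass g).toReal|} := by
  have hV := ballVolume_pos (d := d) hR
  -- Moving the centre by at most `r` changes the local mass by less than a quarter of the ball
  -- volume, for every `g` at once; `ρ` will be the volume of a ball of radius `r`.
  obtain ⟨r, hr0, hr⟩ : ∃ r > 0, ballVolume d (R + r) - ballVolume d R < ballVolume d R / 4 := by
    have h1 := ((tendsto_ballVolume_add (d := d) hR.le).mono_left
      (nhdsWithin_mono _ Set.Ioi_subset_Ici_self)).eventually_lt_const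
      (show 0 < ballVolume d R / 4 by linarith)
    obtain ⟨r, hr, hr0⟩ := (h1.and self_mem_nhdsWithin).exists
    exact ⟨r, hr0, hr⟩
  refine ⟨ballVolume d r, ballVolume_pos hr0, fun g hgm hg hg0 hgb => ?_⟩
  have hmass : mass g ≠ ∞ := ((mass_le_jumpRate hR hg).trans_lt (jumpRate_ne_top hgb).lt_top).ne
  set P := {p : EuclideanSpace ℝ (Fin d) × ℝ | U * ballVolume d R / 4 ≤
    |(mass (reproduce R U p.1 p.2 g)).toReal - (mass g).toReal|}
  have hPm : MeasurableSet P := measurableSet_le measurable_const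
    ((measurable_mass_reproduce hgm).ennreal_toReal.sub_const _).abs
  have hmem : ∀ c v, ballVolume d R / 4 ≤
      |(if v ≤ g c then ballVolume d R else 0) - (localMass R g c).toReal| → (c, v) ∈ P := by
    intro c v h
    change U * ballVolume d R / 4 ≤ |(mass (reproduce R U c v g)).toReal - (mass g).toReal|
    rw [mass_reproduce_sub hU0 hU1 hgm hg hmass, abs_mul, abs_of_pos hU0, mul_div_assoc]
    exact mul_le_mul_of_nonneg_left h hU0.le
  have hlaw : eventLaw R g {z | U * ballVolume d R / 4 ≤
      |(mass (reproduce R U z.2.1 z.2.2 g)).toReal - (mass g).toReal|} =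
      (jumpRate R g)⁻¹ * ∫⁻ c in activeCentres R g, ∫⁻ v in Set.Icc (0 : ℝ) 1,
        P.indicator 1 (c, v) := by
    rw [← lintegral_eventLaw_of_snd hg0 (measurable_one.indicator hPm)]
    exact (lintegral_indicator_one (measurable_snd hPm)).symm
  rw [hlaw, ENNReal.div_eq_inv_mul]
  refine mul_le_mul_right ?_ _
  -- If every ball is less than half Red, any Red parent causes a large gain, and a Red parent has
  -- probability mass over rate. Otherwise there are centres where either type of parent causes a
  -- large change.
  by_cases hcase : ∀ c, (localMass R g c).toReal < ballVolume d R / 2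
  · refine (min_le_left _ _).trans ?_
    rw [mass, ← setLIntegral_activeCentres (g := g) hR _ (fun y hy => by simp [hy])]
    refine lintegral_mono fun c => ?_
    dsimp only
    rw [← one_mul (ENNReal.ofReal (g c)), ← setLIntegral_ite_le (hg c)]
    refine lintegral_mono fun v => ?_
    dsimp only
    split_ifs with hv
    · rw [Set.indicator_of_mem]
      · rfl
      · refine hmem c v ?_
        rw [if_pos hv]
        refine le_trans ?_ (le_abs_self _)
        linarith [hcase c]
    · exact zero_le
  · push Not at hcase
    obtain ⟨c₁, hc₁⟩ := hcase
    -- The active centres have finite volume, whereas the whole space has infinite volume since `d ≥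
    -- 1`.
    obtain ⟨c₀, hc₀⟩ : ∃ c₀, c₀ ∉ activeCentres R g := by
      by_contra! h
      have : Nonempty (Fin d) := ⟨⟨0, hd⟩⟩
      have hu : activeCentres R g = Set.univ := Set.eq_univ_of_forall h
      have := jumpRate_ne_top (R := R) hgb
      rw [jumpRate, hu, measure_univ_of_isAddLeftInvariant] at this
      exact this rfl
    have hc₀' : (localMass R g c₀).toReal ≤ ballVolume d R / 2 := by
      by_contra! h
      exact hc₀ (mem_activeCentres_of_localMass_pos (by linarith))
    -- By the intermediate value theorem some ball is exactly half Red. Within distance `r` of its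
    -- centre the Red share stays between one and three quarters.
    obtain ⟨x, hx⟩ := mem_range_of_exists_le_of_exists_ge (continuous_localMass hg hR.le)
      ⟨c₀, hc₀'⟩ ⟨c₁, hc₁⟩
    dsimp only at hx
    have hball : ∀ c ∈ Metric.closedBall x r,
        ballVolume d R / 4 ≤ (localMass R g c).toReal ∧
          (localMass R g c).toReal ≤ 3 * ballVolume d R / 4 := by
      intro c hc
      have h2 := localMass_le (R := R) (c := c) (c' := x) hg hr0.le hc
      have h3 := localMass_le (R := R) (c := x) (c' := c) hg hr0.le (by rwa [dist_comm])
      constructor <;> linarith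
    have hsub : Metric.closedBall x r ⊆ activeCentres R g := fun c hc =>
      mem_activeCentres_of_localMass_pos (by linarith [(hball c hc).1])
    refine (min_le_right _ _).trans ?_
    rw [ofReal_ballVolume x, ← setLIntegral_one]
    refine le_trans ?_ (lintegral_mono_set hsub)
    refine setLIntegral_mono' measurableSet_closedBall fun c hc => ?_
    have : ∀ v, P.indicator (1 : EuclideanSpace ℝ (Fin d) × ℝ → ℝ≥0∞) (c, v) = 1 := by
      intro v
      rw [Set.indicator_of_mem]
      · rfl
      · refine hmem c v ?_
        obtain ⟨h1, h2⟩ := hball c hc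
        split_ifs
        · refine le_trans ?_ (le_abs_self _)
          linarith
        · refine le_trans ?_ (neg_le_abs _)
          linarith
    simp [this]

end JumpSize

/-! ### The conditional law of events along the chain, and the mass martingale -/

section Kernel

variable {d : ℕ} {R U : ℝ} {g f : EuclideanSpace ℝ (Fin d) → ℝ}

/-- The dependence on the state is moved from the measure into the set and a scalar, so that
measurability in the state becomes measurability of sections under one fixed measure. -/
lemma eventLaw_apply (hg0 : g ≠ 0) {S : Set (ℝ × EuclideanSpace ℝ (Fin d) × ℝ)}
    (hS : MeasurableSet S) :
    eventLaw R g S = (jumpRate R g)⁻¹ *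
      ((expMeasure 1).prod (volume.prod (volume.restrict (Set.Icc (0 : ℝ) 1))))
        {z | z ∈ S ∧ z.2.1 ∈ activeCentres R g} := by
  have h3 := isProbabilityMeasure_expMeasure one_pos
  have h4 : (volume.restrict (activeCentres R g)).prod (volume.restrict (Set.Icc (0 : ℝ) 1)) =
      (volume.prod (volume.restrict (Set.Icc (0 : ℝ) 1))).restrict
        (activeCentres R g ×ˢ Set.univ) := by
    rw [← Measure.prod_restrict, Measure.restrict_univ]
  have h5 := Measure.prod_restrict (μ := expMeasure 1)
    (ν := volume.prod (volume.restrict (Set.Icc (0 : ℝ) 1))) Set.univ (activeCentres R g ×ˢ Set.univ)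
  rw [Measure.restrict_univ] at h5
  rw [eventLaw, centreLaw, if_neg hg0, ProbabilityTheory.cond, ← jumpRate, Measure.prod_smul_left,
    Measure.prod_smul_right, Measure.smul_apply, smul_eq_mul, h4, h5, Measure.restrict_apply hS]
  congr 2
  ext z
  simp

section Generic

variable {Ω : Type*} [MeasurableSpace Ω] {c : ℕ → Ω → EuclideanSpace ℝ (Fin d)} {v : ℕ → Ω → ℝ}

lemma measurable_eventLaw_jumpChain (hR : 0 < R) (hU0 : 0 < U) (hU1 : U < 1)
    (hf : Measurable f) (hf1 : ∀ y, f y ∈ Set.Icc (0 : ℝ) 1) (hf0 : f ≠ 0) (n : ℕ)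
    (hc : ∀ i < n, Measurable (c i)) (hv : ∀ i < n, Measurable (v i))
    {S : Set (ℝ × EuclideanSpace ℝ (Fin d) × ℝ)} (hS : MeasurableSet S) :
    Measurable fun ω => eventLaw R (jumpChain R U f (c · ω) (v · ω) n) S := by
  have h3 := isProbabilityMeasure_expMeasure one_pos
  simp only [eventLaw_apply (jumpChain_ne_zero hU0 hU1 hf1 hf0 n) hS]
  refine (measurable_jumpRate_jumpChain hR hU0 hU1 hf hf1 n hc hv).inv.mul ?_
  have hA := measurableSet_activeCentres_jumpChain hR hU0 hU1 hf hf1 n hc hv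
  have hpair : Measurable fun p : Ω × ℝ × EuclideanSpace ℝ (Fin d) × ℝ => (p.1, p.2.2.1) := by
    fun_prop
  exact measurable_measure_prodMk_left ((measurable_snd hS).inter (hpair hA))

lemma measurable_mass_jumpChain (hf : Measurable f) (n : ℕ) (hc : ∀ i < n, Measurable (c i))
    (hv : ∀ i < n, Measurable (v i)) :
    Measurable fun ω => mass (jumpChain R U f (c · ω) (v · ω) n) :=
  (measurable_jumpChain hf n hc hv).ennreal_ofReal.lintegral_prod_right'

lemma measurable_mass_reproduce_jumpChain (hf : Measurable f) (n : ℕ)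
    (hc : ∀ i < n, Measurable (c i)) (hv : ∀ i < n, Measurable (v i)) :
    Measurable fun p : Ω × ℝ × EuclideanSpace ℝ (Fin d) × ℝ =>
      mass (reproduce R U p.2.2.1 p.2.2.2 (jumpChain R U f (c · p.1) (v · p.1) n)) := by
  have h := measurable_jumpChain (R := R) (U := U) hf n hc hv
  have hpair : Measurable fun q : (Ω × ℝ × EuclideanSpace ℝ (Fin d) × ℝ) ×
      EuclideanSpace ℝ (Fin d) => (q.1.1, q.2) := by
    fun_prop
  exact (measurable_reproduce (R := R) (U := U)
    (c := fun p : Ω × ℝ × EuclideanSpace ℝ (Fin d) × ℝ => p.2.2.1)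
    (v := fun p => p.2.2.2) (g := fun p => jumpChain R U f (c · p.1) (v · p.1) n) (by fun_prop)
    (by fun_prop) (h.comp hpair)).ennreal_ofReal.lintegral_prod_right'

lemma measurableSet_large_jump_jumpChain (hf : Measurable f) (n : ℕ)
    (hc : ∀ i < n, Measurable (c i)) (hv : ∀ i < n, Measurable (v i)) (η : ℝ) :
    MeasurableSet {p : Ω × ℝ × EuclideanSpace ℝ (Fin d) × ℝ | η ≤
      |(mass (reproduce R U p.2.2.1 p.2.2.2 (jumpChain R U f (c · p.1) (v · p.1) n))).toReal -
        (mass (jumpChain R U f (c · p.1) (v · p.1) n)).toReal|} :=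
  measurableSet_le measurable_const
    ((measurable_mass_reproduce_jumpChain hf n hc hv).ennreal_toReal.sub
      ((measurable_mass_jumpChain hf n hc hv).comp measurable_fst).ennreal_toReal).abs

end Generic

lemma mass_jumpChain_le (hR : 0 < R) (hU0 : 0 < U) (hU1 : U < 1)
    (hf1 : ∀ y, f y ∈ Set.Icc (0 : ℝ) 1) (cs : ℕ → EuclideanSpace ℝ (Fin d)) (vs : ℕ → ℝ) (n : ℕ) :
    mass (jumpChain R U f cs vs n) ≤ jumpRate R f +
      n * volume (Metric.closedBall (0 : EuclideanSpace ℝ (Fin d)) (R + R)) :=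
  (mass_le_jumpRate hR (jumpChain_mem_Icc hU0 hU1 hf1 n)).trans
    (jumpRate_jumpChain_le hR hU0 hU1 hf1 n)

lemma mass_jumpChain_ne_top (hR : 0 < R) (hU0 : 0 < U) (hU1 : U < 1)
    (hf1 : ∀ y, f y ∈ Set.Icc (0 : ℝ) 1) (hfb : Bornology.IsBounded (Function.support f))
    (cs : ℕ → EuclideanSpace ℝ (Fin d)) (vs : ℕ → ℝ) (n : ℕ) :
    mass (jumpChain R U f cs vs n) ≠ ∞ :=
  ((mass_le_jumpRate hR (jumpChain_mem_Icc hU0 hU1 hf1 n)).trans_lt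
    (jumpRate_ne_top (isBounded_support_jumpChain hU0 hU1 hf1 hfb n)).lt_top).ne

/-- Comparison with the harmonic series, the form in which the linear growth of the rate enters. -/
lemma tsum_eq_top_of_eventually_le {p : ℕ → ℝ≥0∞} {k : ℝ} (hk : 0 < k)
    (h : ∀ᶠ n : ℕ in atTop, ENNReal.ofReal (k / (n + 1)) ≤ p n) : ∑' n, p n = ∞ := by
  by_contra hp
  have hs := ENNReal.summable_toReal hp
  have hs2 : Summable fun n : ℕ => k / ((n : ℝ) + 1) := by
    refine Summable.of_norm_bounded_eventually_nat hs ?_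
    filter_upwards [h] with n hn
    rw [Real.norm_of_nonneg (by positivity)]
    exact (ENNReal.ofReal_le_iff_le_toReal (ENNReal.ne_top_of_tsum_ne_top hp n)).1 hn
  have hs3 : Summable fun n : ℕ => 1 / (n : ℝ) := by
    rw [← summable_nat_add_iff 1]
    refine (hs2.mul_left k⁻¹).congr fun n => ?_
    push_cast
    field_simp
  exact Real.not_summable_one_div_natCast hs3

section Probability

variable {Ω : Type*} [mΩ : MeasurableSpace Ω] {μ : Measure Ω} [IsProbabilityMeasure μ]
  {𝓕 : Filtration ℕ mΩ} {e : ℕ → Ω → ℝ} {c : ℕ → Ω → EuclideanSpace ℝ (Fin d)} {v : ℕ → Ω → ℝ}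

lemma measurable_centre_of_lt
    (hmeas : ∀ n, Measurable[𝓕 (n + 1)] fun ω => (e n ω, c n ω, v n ω)) {i n : ℕ} (h : i < n) :
    Measurable[𝓕 n] (c i) :=
  (measurable_fst.comp (measurable_snd.comp (hmeas i))).mono (𝓕.mono h) le_rfl

lemma measurable_mark_of_lt
    (hmeas : ∀ n, Measurable[𝓕 (n + 1)] fun ω => (e n ω, c n ω, v n ω)) {i n : ℕ} (h : i < n) :
    Measurable[𝓕 n] (v i) :=
  (measurable_snd.comp (measurable_snd.comp (hmeas i))).mono (𝓕.mono h) le_rfl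

/-- The total mass is a martingale along the jump chain. -/
lemma martingale_mass (hR : 0 < R) (hU0 : 0 < U) (hU1 : U < 1) (hf : Measurable f)
    (hf1 : ∀ y, f y ∈ Set.Icc (0 : ℝ) 1) (hf0 : f ≠ 0)
    (hfb : Bornology.IsBounded (Function.support f))
    (hmeas : ∀ n, Measurable[𝓕 (n + 1)] fun ω => (e n ω, c n ω, v n ω))
    (hlaw : ∀ n, ∀ A : Set Ω, MeasurableSet[𝓕 n] A →
      ∀ S : Set (ℝ × EuclideanSpace ℝ (Fin d) × ℝ), MeasurableSet S →
        μ (A ∩ {ω | (e n ω, c n ω, v n ω) ∈ S}) =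
          ∫⁻ ω in A, eventLaw R (jumpChain R U f (c · ω) (v · ω) n) S ∂μ) :
    Martingale (fun n ω => (mass (jumpChain R U f (c · ω) (v · ω) n)).toReal) 𝓕 μ := by
  have hM : ∀ n, Measurable[𝓕 n] fun ω => mass (jumpChain R U f (c · ω) (v · ω) n) := fun n =>
    @measurable_mass_jumpChain d R U f Ω (𝓕 n) c v hf n
      (fun i hi => measurable_centre_of_lt hmeas hi) (fun i hi => measurable_mark_of_lt hmeas hi)
  have hfin := fun n ω => mass_jumpChain_ne_top hR hU0 hU1 hf1 hfb (c · ω) (v · ω) n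
  have hprob : ∀ n ω, IsProbabilityMeasure (eventLaw R (jumpChain R U f (c · ω) (v · ω) n)) :=
    fun n ω => isProbabilityMeasure_eventLaw hR (jumpChain_ne_zero hU0 hU1 hf1 hf0 n)
      (isBounded_support_jumpChain hU0 hU1 hf1 hfb n)
  refine martingale_of_setIntegral_eq_succ (fun n => (hM n).ennreal_toReal.stronglyMeasurable)
    (fun n => ?_) (fun n A hA => ?_)
  · have hle := fun ω => mass_jumpChain_le hR hU0 hU1 hf1 (c · ω) (v · ω) n
    refine Integrable.of_bound
      ((hM n).mono (𝓕.le n) le_rfl).ennreal_toReal.aestronglyMeasurable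
      (jumpRate R f + n * volume (Metric.closedBall (0 : EuclideanSpace ℝ (Fin d)) (R + R))).toReal
      (ae_of_all _ fun ω => ?_)
    rw [Real.norm_of_nonneg ENNReal.toReal_nonneg]
    refine ENNReal.toReal_mono (ENNReal.add_ne_top.2 ⟨jumpRate_ne_top hfb,
      ENNReal.mul_ne_top (ENNReal.natCast_ne_top n) measure_closedBall_lt_top.ne⟩) (hle ω)
  · rw [integral_toReal ((hM n).mono (𝓕.le n) le_rfl).aemeasurable
        (ae_of_all _ fun ω => (hfin n ω).lt_top),
      integral_toReal ((hM (n + 1)).mono (𝓕.le (n + 1)) le_rfl).aemeasurable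
        (ae_of_all _ fun ω => (hfin (n + 1) ω).lt_top)]
    congr 1
    have hA' : MeasurableSet A := 𝓕.le n A hA
    -- `H` is the mass after the event, restricted to `A`, as a function of the past and of the new
    -- event; disintegration reduces the martingale property to `lintegral_mass_reproduce` in each
    -- frozen state.
    let H : Ω × ℝ × EuclideanSpace ℝ (Fin d) × ℝ → ℝ≥0∞ := fun p => A.indicator 1 p.1 *
      mass (reproduce R U p.2.2.1 p.2.2.2 (jumpChain R U f (c · p.1) (v · p.1) n))
    have hH : Measurable[(𝓕 n).prod inferInstance] H := by
      have h1 := (Measurable.indicator (@measurable_one ℝ≥0∞ _ _ (𝓕 n) _) hA).comp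
        (@measurable_fst Ω (ℝ × EuclideanSpace ℝ (Fin d) × ℝ) (𝓕 n) inferInstance)
      have h2 := @measurable_mass_reproduce_jumpChain d R U f Ω (𝓕 n) c v hf n
        (fun i hi => measurable_centre_of_lt hmeas hi) (fun i hi => measurable_mark_of_lt hmeas hi)
      exact h1.mul h2
    have key := lintegral_eq_lintegral_condLaw_of_le (𝓕.le n) μ
      ((hmeas n).mono (𝓕.le (n + 1)) le_rfl)
      (κ := fun ω => eventLaw R (jumpChain R U f (c · ω) (v · ω) n))
      (fun S hS => @measurable_eventLaw_jumpChain d R U f Ω (𝓕 n) c v hR hU0 hU1 hf hf1 hf0 n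
        (fun i hi => measurable_centre_of_lt hmeas hi)
        (fun i hi => measurable_mark_of_lt hmeas hi) S hS) (hlaw n) hH
    have hstate : ∀ ω, Measurable (jumpChain R U f (c · ω) (v · ω) n) := fun ω =>
      (measurable_jumpChain (Ω := Ω) hf n
        (fun i hi => (measurable_centre_of_lt hmeas hi).mono (𝓕.le n) le_rfl)
        (fun i hi => (measurable_mark_of_lt hmeas hi).mono (𝓕.le n) le_rfl)).comp
          measurable_prodMk_left
    rw [← lintegral_indicator hA', ← lintegral_indicator hA']
    refine Eq.trans (lintegral_congr fun ω => ?_) (key.symm.trans (lintegral_congr fun ω => ?_))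
    · simp only [H]
      by_cases hω : ω ∈ A
      · simp only [Set.indicator_of_mem hω, Pi.one_apply, one_mul]
        exact (lintegral_mass_reproduce hR hU0 hU1 (hstate ω) (jumpChain_mem_Icc hU0 hU1 hf1 n)
          (jumpChain_ne_zero hU0 hU1 hf1 hf0 n) (isBounded_support_jumpChain hU0 hU1 hf1 hfb n)
          (hfin n ω)).symm
      · simp [Set.indicator_of_notMem hω]
    · simp only [H]
      by_cases hω : ω ∈ A
      · simp only [Set.indicator_of_mem hω, Pi.one_apply, one_mul]
        rfl
      · simp [Set.indicator_of_notMem hω]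

end Probability

end Kernel

/-! ### The mass tends to zero, and Red parents cease -/

section Extinction

variable {d : ℕ} {R U : ℝ} {g f : EuclideanSpace ℝ (Fin d) → ℝ}
  {Ω : Type*} [mΩ : MeasurableSpace Ω] {μ : Measure Ω} [IsProbabilityMeasure μ]
  {𝓕 : Filtration ℕ mΩ} {e : ℕ → Ω → ℝ} {c : ℕ → Ω → EuclideanSpace ℝ (Fin d)} {v : ℕ → Ω → ℝ}

/-- A nonnegative martingale has constant `L¹` norm, here the initial mass, so Doob's convergence
theorem applies. -/
lemma ae_tendsto_mass (hR : 0 < R) (hU0 : 0 < U) (hU1 : U < 1) (hf : Measurable f)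
    (hf1 : ∀ y, f y ∈ Set.Icc (0 : ℝ) 1) (hf0 : f ≠ 0)
    (hfb : Bornology.IsBounded (Function.support f))
    (hmeas : ∀ n, Measurable[𝓕 (n + 1)] fun ω => (e n ω, c n ω, v n ω))
    (hlaw : ∀ n, ∀ A : Set Ω, MeasurableSet[𝓕 n] A →
      ∀ S : Set (ℝ × EuclideanSpace ℝ (Fin d) × ℝ), MeasurableSet S →
        μ (A ∩ {ω | (e n ω, c n ω, v n ω) ∈ S}) =
          ∫⁻ ω in A, eventLaw R (jumpChain R U f (c · ω) (v · ω) n) S ∂μ) :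
    ∀ᵐ ω ∂μ, ∃ m, Tendsto (fun n => (mass (jumpChain R U f (c · ω) (v · ω) n)).toReal) atTop
      (𝓝 m) := by
  have hmart := martingale_mass hR hU0 hU1 hf hf1 hf0 hfb hmeas hlaw
  refine hmart.submartingale.exists_ae_tendsto_of_bdd (R := (mass f).toReal.toNNReal) fun n => ?_
  have hint := hmart.setIntegral_eq (zero_le (a := n)) (@MeasurableSet.univ _ (𝓕 0))
  rw [setIntegral_univ, setIntegral_univ] at hint
  have h1 : eLpNorm (fun ω => (mass (jumpChain R U f (c · ω) (v · ω) n)).toReal) 1 μ =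
      ENNReal.ofReal (∫ ω, (mass (jumpChain R U f (c · ω) (v · ω) n)).toReal ∂μ) := by
    rw [eLpNorm_one_eq_lintegral_enorm, ofReal_integral_eq_lintegral_ofReal (hmart.integrable n)
      (ae_of_all _ fun ω => ENNReal.toReal_nonneg)]
    exact lintegral_congr fun ω => Real.enorm_of_nonneg ENNReal.toReal_nonneg
  rw [h1, ← hint]
  simp only [jumpChain, integral_const, probReal_univ, smul_eq_mul, one_mul]
  rfl

/-- Convergence forces the increments to zero. A positive limit would make the conditional
probabilities of an increment of fixed size non-summable, so that such increments recur infinitely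
often. -/
lemma ae_tendsto_mass_zero (hd : 1 ≤ d) (hR : 0 < R) (hU0 : 0 < U) (hU1 : U < 1)
    (hf : Measurable f) (hf1 : ∀ y, f y ∈ Set.Icc (0 : ℝ) 1) (hf0 : f ≠ 0)
    (hfb : Bornology.IsBounded (Function.support f))
    (hmeas : ∀ n, Measurable[𝓕 (n + 1)] fun ω => (e n ω, c n ω, v n ω))
    (hlaw : ∀ n, ∀ A : Set Ω, MeasurableSet[𝓕 n] A →
      ∀ S : Set (ℝ × EuclideanSpace ℝ (Fin d) × ℝ), MeasurableSet S →
        μ (A ∩ {ω | (e n ω, c n ω, v n ω) ∈ S}) =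
          ∫⁻ ω in A, eventLaw R (jumpChain R U f (c · ω) (v · ω) n) S ∂μ) :
    ∀ᵐ ω ∂μ, Tendsto (fun n => (mass (jumpChain R U f (c · ω) (v · ω) n)).toReal) atTop
      (𝓝 0) := by
  obtain ⟨ρ, hρ, hjump⟩ := exists_le_eventLaw_large_jump hd hR hU0 hU1
  have hV := ballVolume_pos (d := d) hR
  have hη : 0 < U * ballVolume d R / 4 := by positivity
  have hprob : ∀ n ω, IsProbabilityMeasure (eventLaw R (jumpChain R U f (c · ω) (v · ω) n)) :=
    fun n ω => isProbabilityMeasure_eventLaw hR (jumpChain_ne_zero hU0 hU1 hf1 hf0 n)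
      (isBounded_support_jumpChain hU0 hU1 hf1 hfb n)
  have hstate : ∀ n ω, Measurable (jumpChain R U f (c · ω) (v · ω) n) := fun n ω =>
    (measurable_jumpChain (Ω := Ω) hf n
      (fun i hi => (measurable_centre_of_lt hmeas hi).mono (𝓕.le n) le_rfl)
      (fun i hi => (measurable_mark_of_lt hmeas hi).mono (𝓕.le n) le_rfl)).comp
        measurable_prodMk_left
  let S : ℕ → Set (Ω × ℝ × EuclideanSpace ℝ (Fin d) × ℝ) := fun n =>
    {p | U * ballVolume d R / 4 ≤
      |(mass (reproduce R U p.2.2.1 p.2.2.2 (jumpChain R U f (c · p.1) (v · p.1) n))).toReal -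
        (mass (jumpChain R U f (c · p.1) (v · p.1) n)).toReal|}
  have hS : ∀ n, MeasurableSet[(𝓕 n).prod inferInstance] (S n) := fun n =>
    @measurableSet_large_jump_jumpChain d R U f Ω (𝓕 n) c v hf n
      (fun i hi => measurable_centre_of_lt hmeas hi) (fun i hi => measurable_mark_of_lt hmeas hi) _
  have hBC := ae_frequently_of_tsum_condLaw_eq_top μ hmeas
    (κ := fun n ω => eventLaw R (jumpChain R U f (c · ω) (v · ω) n))
    (fun n S hS => @measurable_eventLaw_jumpChain d R U f Ω (𝓕 n) c v hR hU0 hU1 hf hf1 hf0 n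
      (fun i hi => measurable_centre_of_lt hmeas hi)
      (fun i hi => measurable_mark_of_lt hmeas hi) S hS) hlaw hS
  filter_upwards [ae_tendsto_mass hR hU0 hU1 hf hf1 hf0 hfb hmeas hlaw, hBC] with ω hm hω
  obtain ⟨m, hm⟩ := hm
  have hm0 : 0 ≤ m := ge_of_tendsto' hm fun n => ENNReal.toReal_nonneg
  rcases hm0.eq_or_lt with rfl | hpos
  · exact hm
  exfalso
  have hfreq : ∃ᶠ n in atTop, (ω, e n ω, c n ω, v n ω) ∈ S n := by
    refine hω ?_
    -- Chosen so that the rate after `n` events is at most `a * (n + 1)`.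
    set a : ℝ := (jumpRate R f).toReal + ballVolume d (R + R) with ha
    have hapos : 0 < a :=
      add_pos_of_nonneg_of_pos ENNReal.toReal_nonneg (ballVolume_pos (by linarith))
    refine tsum_eq_top_of_eventually_le (k := min (m / 2) ρ / a)
      (div_pos (lt_min (by linarith) hρ) hapos) ?_
    filter_upwards [hm.eventually_const_lt (show m / 2 < m by linarith)] with n hn
    refine le_trans ?_ (hjump _ (hstate n ω) (jumpChain_mem_Icc hU0 hU1 hf1 n)
      (jumpChain_ne_zero hU0 hU1 hf1 hf0 n) (isBounded_support_jumpChain hU0 hU1 hf1 hfb n))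
    rw [div_div, ENNReal.ofReal_div_of_pos (by positivity)]
    refine ENNReal.div_le_div ?_ ?_
    · rw [ENNReal.ofReal_min]
      exact min_le_min_right _ (ENNReal.ofReal_le_of_le_toReal hn.le)
    · refine (jumpRate_jumpChain_le hR hU0 hU1 hf1 n).trans ?_
      rw [← ofReal_ballVolume, ← ENNReal.ofReal_toReal (jumpRate_ne_top (R := R) hfb),
        ← ENNReal.ofReal_natCast, ← ENNReal.ofReal_mul (Nat.cast_nonneg n),
        ← ENNReal.ofReal_add ENNReal.toReal_nonneg
          (mul_nonneg (Nat.cast_nonneg n) (ballVolume_pos (by linarith)).le)]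
      refine ENNReal.ofReal_le_ofReal ?_
      have h1 : 0 ≤ (n : ℝ) * (jumpRate R f).toReal :=
        mul_nonneg (Nat.cast_nonneg n) ENNReal.toReal_nonneg
      have h2 : 0 ≤ ballVolume d (R + R) := measureReal_nonneg
      rw [ha]
      linarith
  have hdiff : Tendsto (fun n => |(mass (jumpChain R U f (c · ω) (v · ω) (n + 1))).toReal -
      (mass (jumpChain R U f (c · ω) (v · ω) n)).toReal|) atTop (𝓝 0) := by
    have := (((tendsto_add_atTop_iff_nat 1).2 hm).sub hm).abs
    rwa [sub_self, abs_zero] at this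
  obtain ⟨n, hn1, hn2⟩ := (hfreq.and_eventually (hdiff.eventually_lt_const hη)).exists
  exact absurd hn2 (not_lt.2 hn1)

lemma localMass_le_mass : localMass R g ≤ fun _ => mass g := fun _ => setLIntegral_le_lintegral _ _

/-- Once the mass stays small, all parents are Blue. -/
lemma eventually_lt_of_tendsto_mass_zero (hR : 0 < R) (hU0 : 0 < U) (hU1 : U < 1)
    (hf1 : ∀ y, f y ∈ Set.Icc (0 : ℝ) 1)
    (hfb : Bornology.IsBounded (Function.support f)) {cs : ℕ → EuclideanSpace ℝ (Fin d)}
    {vs : ℕ → ℝ} (hstate : ∀ n, Measurable (jumpChain R U f cs vs n))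
    (h : Tendsto (fun n => (mass (jumpChain R U f cs vs n)).toReal) atTop (𝓝 0)) :
    ∀ᶠ n in atTop, jumpChain R U f cs vs n (cs n) < vs n := by
  have hV := ballVolume_pos (d := d) hR
  have hη : 0 < U * ballVolume d R / 2 := by positivity
  filter_upwards [h.eventually_lt_const (show 0 < ballVolume d R / 2 by linarith),
    ((tendsto_add_atTop_iff_nat 1).2 h).eventually_lt_const hη] with n h1 h2
  -- With at most half a ball volume of Red mass present, a Red parent nets a gain of at least `U`
  -- times half a ball volume, so the next mass would reach the threshold excluded by `h2`.
  by_contra! hle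
  have hsub := mass_reproduce_sub (R := R) (c := cs n) (v := vs n) hU0 hU1 (hstate n)
    (jumpChain_mem_Icc hU0 hU1 hf1 n) (mass_jumpChain_ne_top hR hU0 hU1 hf1 hfb cs vs n)
  rw [if_pos hle] at hsub
  have h3 : (localMass R (jumpChain R U f cs vs n) (cs n)).toReal ≤
      (mass (jumpChain R U f cs vs n)).toReal :=
    ENNReal.toReal_mono (mass_jumpChain_ne_top hR hU0 hU1 hf1 hfb cs vs n) (localMass_le_mass _)
  change (mass (reproduce R U (cs n) (vs n) (jumpChain R U f cs vs n))).toReal < _ at h2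
  have h0 : 0 ≤ (mass (jumpChain R U f cs vs n)).toReal := ENNReal.toReal_nonneg
  nlinarith

end Extinction

/-! ### Marginals of the event law -/

section EventLaw

variable {d : ℕ} {R : ℝ} {g : EuclideanSpace ℝ (Fin d) → ℝ}

lemma eventLaw_holding {s : Set ℝ} [IsProbabilityMeasure (centreLaw R g)] :
    eventLaw R g {z | z.1 ∈ s} = expMeasure 1 s := by
  have h2 : IsProbabilityMeasure (volume.restrict (Set.Icc (0 : ℝ) 1)) := ⟨by simp⟩
  have h3 := isProbabilityMeasure_expMeasure one_pos
  have : {z : ℝ × EuclideanSpace ℝ (Fin d) × ℝ | z.1 ∈ s} = s ×ˢ Set.univ := by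
    ext z
    simp
  rw [this, eventLaw, Measure.prod_prod, measure_univ, mul_one]

lemma expMeasure_one_Iic (x : ℝ) (hx : 0 ≤ x) :
    expMeasure 1 (Set.Iic x) = ENNReal.ofReal (1 - Real.exp (-x)) := by
  have h3 := isProbabilityMeasure_expMeasure one_pos
  rw [← ofReal_cdf, cdf_expMeasure_eq one_pos, if_pos hx, one_mul]

lemma expMeasure_one_Ioi_one : expMeasure 1 (Set.Ioi 1) = ENNReal.ofReal (Real.exp (-1)) := by
  have h3 := isProbabilityMeasure_expMeasure one_pos
  have h4 : 0 ≤ 1 - Real.exp (-1) := by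
    linarith [Real.exp_le_one_iff.2 (show (-1 : ℝ) ≤ 0 by norm_num)]
  rw [← Set.compl_Iic, prob_compl_eq_one_sub measurableSet_Iic, expMeasure_one_Iic 1 zero_le_one,
    ← ENNReal.ofReal_one, ← ENNReal.ofReal_sub _ h4, sub_sub_cancel]

lemma eventLaw_centre (hg0 : g ≠ 0) {s : Set (EuclideanSpace ℝ (Fin d))} (hs : MeasurableSet s)
    (hsub : s ⊆ activeCentres R g) :
    eventLaw R g {z | z.2.1 ∈ s} = (jumpRate R g)⁻¹ * volume s := by
  have hm : MeasurableSet {p : EuclideanSpace ℝ (Fin d) × ℝ | p.1 ∈ s} := measurable_fst hs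
  have h1 := lintegral_eventLaw_of_snd (R := R) hg0
    ((measurable_one (α := ℝ≥0∞)).indicator hm)
  have h2 : ∀ (x : EuclideanSpace ℝ (Fin d)) (u : ℝ),
      {p : EuclideanSpace ℝ (Fin d) × ℝ | p.1 ∈ s}.indicator
        (1 : EuclideanSpace ℝ (Fin d) × ℝ → ℝ≥0∞) (x, u) = s.indicator 1 x := fun x u => rfl
  simp only [h2, lintegral_const, Measure.restrict_apply_univ, Real.volume_Icc, sub_zero,
    ENNReal.ofReal_one, mul_one] at h1
  rw [lintegral_indicator_one hs, Measure.restrict_apply hs, Set.inter_eq_left.2 hsub] at h1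
  rw [← h1]
  exact (lintegral_indicator_one (measurable_snd hm)).symm

lemma isProbabilityMeasure_centreLaw (hR : 0 < R)
    (hgb : Bornology.IsBounded (Function.support g)) : IsProbabilityMeasure (centreLaw R g) := by
  rw [centreLaw]
  split_ifs with hg0
  · infer_instance
  · exact cond_isProbabilityMeasure_of_finite (jumpRate_ne_zero hR hg0) (jumpRate_ne_top hgb)

end EventLaw

/-! ### Events that recur infinitely often -/

section Recurrence

variable {d : ℕ} {R U : ℝ} {f : EuclideanSpace ℝ (Fin d) → ℝ}
  {Ω : Type*} [mΩ : MeasurableSpace Ω] {μ : Measure Ω} [IsProbabilityMeasure μ]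
  {𝓕 : Filtration ℕ mΩ} {e : ℕ → Ω → ℝ} {c : ℕ → Ω → EuclideanSpace ℝ (Fin d)} {v : ℕ → Ω → ℝ}

lemma ae_frequently_mem (hR : 0 < R) (hU0 : 0 < U) (hU1 : U < 1) (hf : Measurable f)
    (hf1 : ∀ y, f y ∈ Set.Icc (0 : ℝ) 1) (hf0 : f ≠ 0)
    (hfb : Bornology.IsBounded (Function.support f))
    (hmeas : ∀ n, Measurable[𝓕 (n + 1)] fun ω => (e n ω, c n ω, v n ω))
    (hlaw : ∀ n, ∀ A : Set Ω, MeasurableSet[𝓕 n] A →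
      ∀ S : Set (ℝ × EuclideanSpace ℝ (Fin d) × ℝ), MeasurableSet S →
        μ (A ∩ {ω | (e n ω, c n ω, v n ω) ∈ S}) =
          ∫⁻ ω in A, eventLaw R (jumpChain R U f (c · ω) (v · ω) n) S ∂μ)
    {S : Set (ℝ × EuclideanSpace ℝ (Fin d) × ℝ)} (hS : MeasurableSet S) :
    ∀ᵐ ω ∂μ, ∑' n, eventLaw R (jumpChain R U f (c · ω) (v · ω) n) S = ∞ →
      ∃ᶠ n in atTop, (e n ω, c n ω, v n ω) ∈ S := by
  have hprob : ∀ n ω, IsProbabilityMeasure (eventLaw R (jumpChain R U f (c · ω) (v · ω) n)) :=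
    fun n ω => isProbabilityMeasure_eventLaw hR (jumpChain_ne_zero hU0 hU1 hf1 hf0 n)
      (isBounded_support_jumpChain hU0 hU1 hf1 hfb n)
  exact ae_frequently_of_tsum_condLaw_eq_top μ hmeas
    (κ := fun n ω => eventLaw R (jumpChain R U f (c · ω) (v · ω) n))
    (fun n S hS => @measurable_eventLaw_jumpChain d R U f Ω (𝓕 n) c v hR hU0 hU1 hf hf1 hf0 n
      (fun i hi => measurable_centre_of_lt hmeas hi)
      (fun i hi => measurable_mark_of_lt hmeas hi) S hS) hlaw
    (S := fun _ => {p | p.2 ∈ S}) (fun n => @measurable_snd Ω _ (𝓕 n) _ S hS)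

/-- In every state the conditional probability is `exp (-1)`. This excludes explosion once the rate
is constant. -/
lemma ae_frequently_one_lt (hR : 0 < R) (hU0 : 0 < U) (hU1 : U < 1) (hf : Measurable f)
    (hf1 : ∀ y, f y ∈ Set.Icc (0 : ℝ) 1) (hf0 : f ≠ 0)
    (hfb : Bornology.IsBounded (Function.support f))
    (hmeas : ∀ n, Measurable[𝓕 (n + 1)] fun ω => (e n ω, c n ω, v n ω))
    (hlaw : ∀ n, ∀ A : Set Ω, MeasurableSet[𝓕 n] A →
      ∀ S : Set (ℝ × EuclideanSpace ℝ (Fin d) × ℝ), MeasurableSet S →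
        μ (A ∩ {ω | (e n ω, c n ω, v n ω) ∈ S}) =
          ∫⁻ ω in A, eventLaw R (jumpChain R U f (c · ω) (v · ω) n) S ∂μ) :
    ∀ᵐ ω ∂μ, ∃ᶠ n in atTop, 1 < e n ω := by
  filter_upwards [ae_frequently_mem hR hU0 hU1 hf hf1 hf0 hfb hmeas hlaw
    (S := {z | z.1 ∈ Set.Ioi 1}) (measurable_fst measurableSet_Ioi)] with ω hω
  refine hω (tsum_eq_top_of_eventually_le (Real.exp_pos (-1)) (Eventually.of_forall fun n => ?_))
  have := isProbabilityMeasure_centreLaw hR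
    (isBounded_support_jumpChain (R := R) (cs := (c · ω)) (vs := (v · ω)) hU0 hU1 hf1 hfb n)
  rw [eventLaw_holding, expMeasure_one_Ioi_one]
  refine ENNReal.ofReal_le_ofReal (div_le_self (Real.exp_pos _).le ?_)
  linarith [(Nat.cast_nonneg n : (0 : ℝ) ≤ n)]

end Recurrence

/-! ### Behaviour of the path once all parents are Blue -/

section BlueParents

variable {d : ℕ} {R U : ℝ} {f : EuclideanSpace ℝ (Fin d) → ℝ} {es : ℕ → ℝ}
  {cs : ℕ → EuclideanSpace ℝ (Fin d)} {vs : ℕ → ℝ} {N : ℕ}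

lemma support_jumpChain_eq_of_le (hU1 : U < 1)
    (hN : ∀ n ≥ N, jumpChain R U f cs vs n (cs n) < vs n) {n : ℕ} (hn : N ≤ n) :
    Function.support (jumpChain R U f cs vs n) = Function.support (jumpChain R U f cs vs N) := by
  induction n, hn using Nat.le_induction with
  | base => rfl
  | succ n hn ih => rw [jumpChain, support_reproduce_of_lt hU1 (hN n hn), ih]

/-- The supports increase and are constant from `N` on. The left side does not mention the random
index `N`, which makes it a measurable description of the limiting support. -/
lemma setOf_exists_jumpChain_ne_zero (hU0 : 0 < U) (hU1 : U < 1)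
    (hf1 : ∀ y, f y ∈ Set.Icc (0 : ℝ) 1) (hN : ∀ n ≥ N, jumpChain R U f cs vs n (cs n) < vs n) :
    {y | ∃ n, jumpChain R U f cs vs n y ≠ 0} = Function.support (jumpChain R U f cs vs N) := by
  ext y
  refine ⟨fun ⟨n, hn⟩ => ?_, fun h => ⟨N, h⟩⟩
  rw [← support_jumpChain_eq_of_le hU1 hN (le_max_right n N)]
  exact support_jumpChain_mono hU0 hU1 hf1 (le_max_left n N) hn

lemma activeCentres_jumpChain_eq_of_le (hU1 : U < 1)
    (hN : ∀ n ≥ N, jumpChain R U f cs vs n (cs n) < vs n) {n : ℕ} (hn : N ≤ n) :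
    activeCentres R (jumpChain R U f cs vs n) = activeCentres R (jumpChain R U f cs vs N) := by
  rw [activeCentres, tsupport, support_jumpChain_eq_of_le hU1 hN hn]
  rfl

lemma jumpChain_succ_le (hU0 : 0 < U) (hU1 : U < 1) (hf1 : ∀ y, f y ∈ Set.Icc (0 : ℝ) 1) {n : ℕ}
    (hn : jumpChain R U f cs vs n (cs n) < vs n) (y : EuclideanSpace ℝ (Fin d)) :
    jumpChain R U f cs vs (n + 1) y ≤ jumpChain R U f cs vs n y := by
  by_cases hy : y ∈ Metric.closedBall (cs n) R
  · rw [jumpChain, reproduce_of_mem hy, if_neg hn.not_ge]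
    nlinarith [(jumpChain_mem_Icc (R := R) (cs := cs) (vs := vs) hU0 hU1 hf1 n y).1]
  · rw [jumpChain, reproduce_of_notMem hy]

lemma jumpChain_le_of_le (hU0 : 0 < U) (hU1 : U < 1) (hf1 : ∀ y, f y ∈ Set.Icc (0 : ℝ) 1)
    (hN : ∀ n ≥ N, jumpChain R U f cs vs n (cs n) < vs n) {k n : ℕ} (hk : N ≤ k) (hkn : k ≤ n)
    (y : EuclideanSpace ℝ (Fin d)) :
    jumpChain R U f cs vs n y ≤ jumpChain R U f cs vs k y := by
  induction n, hkn using Nat.le_induction with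
  | base => exact le_rfl
  | succ n hn ih => exact (jumpChain_succ_le hU0 hU1 hf1 (hN n (hk.trans hn)) y).trans ih

/-- When all parents are Blue, and finitely many balls that cover the support are visited infinitely
often, the Red type decays geometrically and uniformly. -/
lemma exists_jumpChain_le_pow (hU0 : 0 < U) (hU1 : U < 1)
    (hf1 : ∀ y, f y ∈ Set.Icc (0 : ℝ) 1) (hN : ∀ n ≥ N, jumpChain R U f cs vs n (cs n) < vs n)
    (Q : Finset (EuclideanSpace ℝ (Fin d)))
    (hQ : Function.support (jumpChain R U f cs vs N) ⊆ ⋃ q ∈ Q, Metric.ball q (R / 2))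
    (hvisit : ∀ q ∈ Q, ∃ᶠ n in atTop, cs n ∈ Metric.ball q (R / 2)) (k : ℕ) :
    ∃ n₀ ≥ N, ∀ n ≥ n₀, ∀ y, jumpChain R U f cs vs n y ≤ (1 - U) ^ k := by
  induction k with
  | zero => exact ⟨N, le_rfl, fun n _ y => by
      simpa using (jumpChain_mem_Icc hU0 hU1 hf1 n y).2⟩
  | succ k ih =>
    obtain ⟨n₀, hn₀, h⟩ := ih
    -- One visit to each ball after `n₀` gains one more factor `1 - U` everywhere on the support.
    have hex : ∀ q, ∃ n ≥ n₀, q ∈ Q → cs n ∈ Metric.ball q (R / 2) := by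
      intro q
      by_cases hq : q ∈ Q
      · obtain ⟨n, hn, hmem⟩ := (frequently_atTop.1 (hvisit q hq)) n₀
        exact ⟨n, hn, fun _ => hmem⟩
      · exact ⟨n₀, le_rfl, fun h => absurd h hq⟩
    choose j hj hjmem using hex
    refine ⟨max n₀ (Q.sup fun q => j q + 1), hn₀.trans (le_max_left _ _), fun n hn y => ?_⟩
    have hNn : N ≤ n := hn₀.trans ((le_max_left _ _).trans hn)
    by_cases hy : y ∈ Function.support (jumpChain R U f cs vs N)
    · obtain ⟨q, hq, hyq⟩ := Set.mem_iUnion₂.1 (hQ hy)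
      have hjn : j q + 1 ≤ n :=
        (Finset.le_sup (f := fun q => j q + 1) hq).trans ((le_max_right _ _).trans hn)
      have hNj : N ≤ j q := hn₀.trans (hj q)
      refine (jumpChain_le_of_le hU0 hU1 hf1 hN (hNj.trans (Nat.le_succ _)) hjn y).trans ?_
      -- Both `y` and the centre `cs (j q)` are within `R / 2` of `q`; this is why the cover uses
      -- half the radius.
      have hball : y ∈ Metric.closedBall (cs (j q)) R := by
        have h1 := hjmem q hq
        rw [Metric.mem_ball] at h1 hyq
        rw [Metric.mem_closedBall]
        linarith [dist_triangle_right y (cs (j q)) q]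
      rw [jumpChain, reproduce_of_mem hball, if_neg (hN _ hNj).not_ge, mul_zero, add_zero, pow_succ']
      exact mul_le_mul_of_nonneg_left (h _ (hj q) y) (by linarith)
    · rw [← support_jumpChain_eq_of_le hU1 hN hNn, Function.notMem_support] at hy
      rw [hy]
      exact pow_nonneg (by linarith) _

lemma jumpTime_mono : Monotone (jumpTime R U f es cs vs) :=
  monotone_nat_of_le_succ fun _ => le_self_add

lemma jumpTime_ne_top (hR : 0 < R) (hU0 : 0 < U) (hU1 : U < 1)
    (hf1 : ∀ y, f y ∈ Set.Icc (0 : ℝ) 1) (hf0 : f ≠ 0) (n : ℕ) :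
    jumpTime R U f es cs vs n ≠ ∞ := by
  induction n with
  | zero => exact ENNReal.zero_ne_top
  | succ n ih =>
    exact ENNReal.add_ne_top.2 ⟨ih, ENNReal.div_ne_top ENNReal.ofReal_ne_top
      (jumpRate_ne_zero hR (jumpChain_ne_zero hU0 hU1 hf1 hf0 n))⟩

/-- Once the rate is frozen at `r`, every normalised holding time above `1` adds at least `1 / r` to
the clock, so the event times are unbounded. -/
lemma exists_lt_jumpTime {r : ℝ≥0∞} (hr : r ≠ ∞) (hr0 : r ≠ 0)
    (hrate : ∀ n ≥ N, jumpRate R (jumpChain R U f cs vs n) = r)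
    (he : ∃ᶠ n in atTop, 1 < es n) (t : ℝ≥0) : ∃ n, (t : ℝ≥0∞) < jumpTime R U f es cs vs n := by
  have hgrow : ∀ k : ℕ, ∃ n, (k : ℝ≥0∞) / r ≤ jumpTime R U f es cs vs n := by
    intro k
    induction k with
    | zero => exact ⟨0, by simp⟩
    | succ k ih =>
      obtain ⟨n, hn⟩ := ih
      obtain ⟨m, hm, hem⟩ := (frequently_atTop.1 he) (max n N)
      refine ⟨m + 1, ?_⟩
      rw [jumpTime, hrate m ((le_max_right _ _).trans hm), Nat.cast_succ, ENNReal.add_div]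
      refine add_le_add (hn.trans (jumpTime_mono ((le_max_left _ _).trans hm)))
        (ENNReal.div_le_div_right ?_ r)
      exact ENNReal.one_le_ofReal.2 hem.le
  obtain ⟨k, hk⟩ := ENNReal.exists_nat_gt (ENNReal.mul_ne_top (ENNReal.coe_ne_top (r := t)) hr)
  obtain ⟨n, hn⟩ := hgrow k
  exact ⟨n, ((ENNReal.lt_div_iff_mul_lt (Or.inl hr0) (Or.inl hr)).2 hk).trans_le hn⟩

lemma exists_jumpTime_le_lt {t : ℝ≥0} (h : ∃ n, (t : ℝ≥0∞) < jumpTime R U f es cs vs n) :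
    ∃ n, jumpTime R U f es cs vs n ≤ t ∧ (t : ℝ≥0∞) < jumpTime R U f es cs vs (n + 1) := by
  classical
  obtain ⟨n, hn⟩ : ∃ n, Nat.find h = n + 1 := by
    refine Nat.exists_eq_succ_of_ne_zero fun h0 => ?_
    have := Nat.find_spec h
    rw [h0] at this
    exact not_lt_zero this
  refine ⟨n, not_lt.1 (Nat.find_min h (by omega)), ?_⟩
  have := Nat.find_spec h
  rwa [hn] at this

end BlueParents

/-! ### Covering the limiting support by recurrent balls -/

section AbsorbingCover

variable {d : ℕ} {R U : ℝ} {f : EuclideanSpace ℝ (Fin d) → ℝ} {cs : ℕ → EuclideanSpace ℝ (Fin d)}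
  {vs : ℕ → ℝ} {N : ℕ}

/-- From `N` on the active centres are frozen, so the terms equal one positive constant. -/
lemma tsum_eventLaw_centre_eq_top (hR : 0 < R) (hU0 : 0 < U) (hU1 : U < 1)
    (hf1 : ∀ y, f y ∈ Set.Icc (0 : ℝ) 1) (hf0 : f ≠ 0)
    (hfb : Bornology.IsBounded (Function.support f))
    (hN : ∀ n ≥ N, jumpChain R U f cs vs n (cs n) < vs n) {q : EuclideanSpace ℝ (Fin d)}
    (hq : Metric.ball q (R / 2) ⊆ activeCentres R (jumpChain R U f cs vs N)) :
    ∑' n, eventLaw R (jumpChain R U f cs vs n) {z | z.2.1 ∈ Metric.ball q (R / 2)} = ∞ := by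
  set p := (jumpRate R (jumpChain R U f cs vs N))⁻¹ * volume (Metric.ball q (R / 2)) with hp
  have hrate := jumpRate_ne_zero hR (jumpChain_ne_zero (R := R) (cs := cs) (vs := vs)
    hU0 hU1 hf1 hf0 N)
  have hrate' := jumpRate_ne_top (R := R) (isBounded_support_jumpChain (R := R) (cs := cs)
    (vs := vs) hU0 hU1 hf1 hfb N)
  have hp0 : p ≠ 0 := mul_ne_zero (ENNReal.inv_ne_zero.2 hrate')
    (Metric.measure_ball_pos volume q (half_pos hR)).ne'
  have hp1 : p ≠ ∞ := ENNReal.mul_ne_top (ENNReal.inv_ne_top.2 hrate) measure_ball_lt_top.ne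
  refine tsum_eq_top_of_eventually_le (ENNReal.toReal_pos hp0 hp1) ?_
  filter_upwards [eventually_ge_atTop N] with n hn
  have hA := activeCentres_jumpChain_eq_of_le (R := R) hU1 hN hn
  rw [eventLaw_centre (jumpChain_ne_zero hU0 hU1 hf1 hf0 n) measurableSet_ball (hA ▸ hq), jumpRate,
    hA, ← jumpRate, ← hp]
  refine (ENNReal.ofReal_le_ofReal (div_le_self ENNReal.toReal_nonneg ?_)).trans_eq
    (ENNReal.ofReal_toReal hp1)
  linarith [(Nat.cast_nonneg n : (0 : ℝ) ≤ n)]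

/-- Finitely many small balls, with centres in a given dense sequence, cover the support, and they
consist of active centres. -/
lemma exists_finset_cover_support (hR : 0 < R) {g : EuclideanSpace ℝ (Fin d) → ℝ}
    (hgb : Bornology.IsBounded (Function.support g)) :
    ∃ Q : Finset (EuclideanSpace ℝ (Fin d)),
      Function.support g ⊆ ⋃ q ∈ Q, Metric.ball q (R / 2) ∧
      ∀ q ∈ Q, (∃ i, TopologicalSpace.denseSeq (EuclideanSpace ℝ (Fin d)) i = q) ∧
        Metric.ball q (R / 2) ⊆ activeCentres R g := by
  have hcomp : IsCompact (tsupport g) := hgb.isCompact_closure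
  have hnear : ∀ x : EuclideanSpace ℝ (Fin d), ∃ i,
      x ∈ Metric.ball (TopologicalSpace.denseSeq (EuclideanSpace ℝ (Fin d)) i) (R / 2) := by
    intro x
    obtain ⟨i, hi⟩ := (TopologicalSpace.denseRange_denseSeq
      (EuclideanSpace ℝ (Fin d))).exists_dist_lt x (half_pos hR)
    exact ⟨i, hi⟩
  choose i hi using hnear
  obtain ⟨t, ht, hcov⟩ := hcomp.elim_nhds_subcover
    (fun x => Metric.ball (TopologicalSpace.denseSeq (EuclideanSpace ℝ (Fin d)) (i x)) (R / 2))
    fun x _ => Metric.isOpen_ball.mem_nhds (hi x)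
  classical
  refine ⟨t.image fun x => TopologicalSpace.denseSeq (EuclideanSpace ℝ (Fin d)) (i x), ?_, ?_⟩
  · rw [Finset.set_biUnion_finset_image]
    exact (subset_tsupport g).trans hcov
  · intro q hq
    obtain ⟨x, hx, rfl⟩ := Finset.mem_image.1 hq
    refine ⟨⟨_, rfl⟩, fun y hy => closedBall_subset_activeCentres (ht x hx) ?_⟩
    have h1 := hi x
    rw [Metric.mem_ball] at h1 hy
    rw [Metric.mem_closedBall]
    linarith [dist_triangle_right y x (TopologicalSpace.denseSeq (EuclideanSpace ℝ (Fin d)) (i x))]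

/-- Needed for the absorbing state: the rate is `0` there, and in `ℝ≥0∞` a quotient by `0` is
infinite only if the numerator is nonzero. -/
lemma ae_pos_holding {Ω : Type*} [mΩ : MeasurableSpace Ω] {μ : Measure Ω} [IsProbabilityMeasure μ]
    (hR : 0 < R) (hfb : Bornology.IsBounded (Function.support f)) {𝓕 : Filtration ℕ mΩ}
    {e : ℕ → Ω → ℝ} {c : ℕ → Ω → EuclideanSpace ℝ (Fin d)} {v : ℕ → Ω → ℝ}
    (hlaw : ∀ n, ∀ A : Set Ω, MeasurableSet[𝓕 n] A →
      ∀ S : Set (ℝ × EuclideanSpace ℝ (Fin d) × ℝ), MeasurableSet S →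
        μ (A ∩ {ω | (e n ω, c n ω, v n ω) ∈ S}) =
          ∫⁻ ω in A, eventLaw R (jumpChain R U f (c · ω) (v · ω) n) S ∂μ) :
    ∀ᵐ ω ∂μ, 0 < e 0 ω := by
  have := isProbabilityMeasure_centreLaw hR hfb
  have h := hlaw 0 Set.univ (@MeasurableSet.univ _ (𝓕 0)) {z | z.1 ∈ Set.Iic 0}
    (measurable_fst measurableSet_Iic)
  simp only [jumpChain, eventLaw_holding, expMeasure_one_Iic 0 le_rfl, neg_zero, Real.exp_zero,
    sub_self, ENNReal.ofReal_zero, lintegral_zero, Set.univ_inter] at h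
  rw [ae_iff]
  convert h using 2
  ext ω
  simp

end AbsorbingCover

/-! ### The main theorem -/

theorem theorem1 {d : ℕ} (hd : 1 ≤ d) {Ω : Type*} [MeasurableSpace Ω] (μ : Measure Ω)
    [IsProbabilityMeasure μ] (R U : ℝ) (hR : 0 < R) (hU0 : 0 < U) (hU1 : U < 1)
    (f : EuclideanSpace ℝ (Fin d) → ℝ) (hf_meas : Measurable f)
    (hf_range : ∀ y, f y ∈ Set.Icc (0 : ℝ) 1)
    (hf_supp : Bornology.IsBounded (Function.support f))
    (X : ℝ≥0 → Ω → EuclideanSpace ℝ (Fin d) → ℝ)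
    (hX : IsSpatialFlemingViot μ R U f X) :
    ∃ (B : Ω → Set (EuclideanSpace ℝ (Fin d))) (T : Ω → ℝ≥0),
      MeasurableSet {p : Ω × EuclideanSpace ℝ (Fin d) | p.2 ∈ B p.1} ∧ Measurable T ∧
      ∀ᵐ ω ∂μ,
        Bornology.IsBounded (B ω) ∧
        (∀ t : ℝ≥0, T ω < t →
          Function.support (X t ω) = B ω ∧ tsupport (X t ω) = closure (B ω)) ∧
        Tendsto (fun t : ℝ≥0 => ⨆ z ∈ B ω, ‖X t ω z‖ₑ) atTop (𝓝 0) := by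
  obtain ⟨𝓕, e, c, v, hmeas, hlaw, hpath⟩ := hX
  rcases eq_or_ne f 0 with hf0 | hf0
  · refine ⟨fun _ => ∅, fun _ => 0, by simp, measurable_const, ?_⟩
    filter_upwards [hpath, ae_pos_holding hR hf_supp hlaw] with ω hω he
    have hX0 : ∀ t, X t ω = 0 := by
      intro t
      have h := hω 0 t
      simp only [jumpTime, jumpChain] at h
      rw [← hf0]
      refine h zero_le ?_
      have hrate : jumpRate R f = 0 := by
        rw [hf0, jumpRate, activeCentres, show tsupport (0 : EuclideanSpace ℝ (Fin d) → ℝ) = ∅ by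
          simp [tsupport], Metric.cthickening_empty, measure_empty]
      rw [hrate, ENNReal.div_zero (ENNReal.ofReal_pos.2 he).ne', add_top]
      exact ENNReal.coe_lt_top
    refine ⟨Bornology.isBounded_empty, fun t _ => ?_, ?_⟩
    · simp [hX0, tsupport]
    · simp
  have hc : ∀ n, Measurable (c n) := fun n =>
    (measurable_centre_of_lt hmeas n.lt_succ_self).mono (𝓕.le _) le_rfl
  have hv : ∀ n, Measurable (v n) := fun n =>
    (measurable_mark_of_lt hmeas n.lt_succ_self).mono (𝓕.le _) le_rfl
  have he : ∀ n, Measurable (e n) := fun n =>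
    (measurable_fst.comp (hmeas n)).mono (𝓕.le _) le_rfl
  have hchain : ∀ n, Measurable (Function.uncurry fun ω => jumpChain R U f (c · ω) (v · ω) n) :=
    fun n => measurable_jumpChain hf_meas n (fun i _ => hc i) fun i _ => hv i
  -- The time of the last event with a Red parent. As a supremum it is measurable without selecting
  -- the random index of that event; it is almost surely finite, so `toNNReal` loses nothing.
  let τ : Ω → ℝ≥0∞ := fun ω => ⨆ n, if v n ω ≤ jumpChain R U f (c · ω) (v · ω) n (c n ω) then
    jumpTime R U f (e · ω) (c · ω) (v · ω) (n + 1) else 0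
  refine ⟨fun ω => {y | ∃ n, jumpChain R U f (c · ω) (v · ω) n y ≠ 0}, fun ω => (τ ω).toNNReal,
    ?_, ?_, ?_⟩
  · have : {p : Ω × EuclideanSpace ℝ (Fin d) |
        p.2 ∈ {y | ∃ n, jumpChain R U f (c · p.1) (v · p.1) n y ≠ 0}} =
        ⋃ n, (Function.uncurry fun ω => jumpChain R U f (c · ω) (v · ω) n) ⁻¹' {0}ᶜ := by
      ext p
      simp [Function.uncurry]
    rw [this]
    exact MeasurableSet.iUnion fun n => hchain n (measurableSet_singleton 0).compl
  · refine (Measurable.iSup fun n => Measurable.ite ?_ ?_ measurable_const).ennreal_toNNReal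
    · exact measurableSet_red hf_meas n (fun i _ => hc i) fun i _ => hv i
    · exact measurable_jumpTime hR hU0 hU1 hf_meas hf_range he hc hv (n + 1)
  -- The covering balls depend on the random final support. Centring them on a fixed dense sequence
  -- leaves countably many candidates, hence a single null set.
  have hvisit : ∀ᵐ ω ∂μ, ∀ i, ∑' n, eventLaw R (jumpChain R U f (c · ω) (v · ω) n)
      {z | z.2.1 ∈ Metric.ball
        (TopologicalSpace.denseSeq (EuclideanSpace ℝ (Fin d)) i) (R / 2)} = ∞ →
      ∃ᶠ n in atTop, c n ω ∈ Metric.ball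
        (TopologicalSpace.denseSeq (EuclideanSpace ℝ (Fin d)) i) (R / 2) :=
    ae_all_iff.2 fun i => ae_frequently_mem hR hU0 hU1 hf_meas hf_range hf0 hf_supp hmeas hlaw
      ((measurable_fst.comp measurable_snd) measurableSet_ball)
  filter_upwards [hpath, hvisit,
    ae_frequently_one_lt hR hU0 hU1 hf_meas hf_range hf0 hf_supp hmeas hlaw,
    ae_tendsto_mass_zero hd hR hU0 hU1 hf_meas hf_range hf0 hf_supp hmeas hlaw]
    with ω hω hvis he1 hmass
  obtain ⟨N, hN⟩ := eventually_atTop.1 (eventually_lt_of_tendsto_mass_zero hR hU0 hU1 hf_range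
    hf_supp (fun n => show Measurable (jumpChain R U f (c · ω) (v · ω) n) from
      (hchain n).comp measurable_prodMk_left) hmass)
  have hB := setOf_exists_jumpChain_ne_zero hU0 hU1 hf_range hN
  have hbdd := isBounded_support_jumpChain (R := R) (cs := (c · ω)) (vs := (v · ω)) hU0 hU1
    hf_range hf_supp N
  have hne := jumpChain_ne_zero (R := R) (cs := (c · ω)) (vs := (v · ω)) hU0 hU1 hf_range hf0 N
  have hfin := jumpTime_ne_top (es := (e · ω)) (cs := (c · ω)) (vs := (v · ω)) hR hU0 hU1
    hf_range hf0
  have hindex : ∀ t : ℝ≥0, ∃ n, jumpTime R U f (e · ω) (c · ω) (v · ω) n ≤ t ∧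
      (t : ℝ≥0∞) < jumpTime R U f (e · ω) (c · ω) (v · ω) (n + 1) := fun t =>
    exists_jumpTime_le_lt (exists_lt_jumpTime (jumpRate_ne_top hbdd) (jumpRate_ne_zero hR hne)
      (fun n hn => by rw [jumpRate, activeCentres_jumpChain_eq_of_le hU1 hN hn]; rfl) he1 t)
  have hτ : τ ω ≠ ∞ := by
    refine ((iSup_le fun n => ?_).trans_lt (hfin N).lt_top).ne
    split_ifs with hred
    · refine jumpTime_mono (Nat.succ_le_of_lt ?_)
      by_contra! h
      exact absurd hred (hN n h).not_ge
    · exact zero_le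
  refine ⟨hB ▸ hbdd, fun t ht => ?_, ?_⟩
  · have hsupp : Function.support (X t ω) =
        {y | ∃ n, jumpChain R U f (c · ω) (v · ω) n y ≠ 0} := by
      obtain ⟨n, hn1, hn2⟩ := hindex t
      rw [hω n t hn1 hn2]
      -- The support is already frozen at the current index `n`: a Red parent at some `k ≥ n` would
      -- put the time of event `k + 1` at most `τ ω`, hence before `t`, although `t` precedes event
      -- `n + 1`.
      refine (setOf_exists_jumpChain_ne_zero hU0 hU1 hf_range fun k hk => ?_).symm
      by_contra! hred
      have h1 : jumpTime R U f (e · ω) (c · ω) (v · ω) (k + 1) ≤ τ ω :=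
        (le_of_eq (if_pos hred).symm).trans (le_iSup (fun n =>
          if v n ω ≤ jumpChain R U f (c · ω) (v · ω) n (c n ω) then
            jumpTime R U f (e · ω) (c · ω) (v · ω) (n + 1) else 0) k)
      have h2 : τ ω < t := by
        rw [← ENNReal.coe_toNNReal hτ]
        exact ENNReal.coe_lt_coe.2 ht
      exact lt_irrefl _ ((h1.trans_lt h2).trans
        (hn2.trans_le (jumpTime_mono (Nat.succ_le_succ hk))))
    exact ⟨hsupp, by rw [tsupport, hsupp]⟩
  · obtain ⟨Q, hQ, hQ'⟩ := exists_finset_cover_support hR hbdd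
    have hdecay := exists_jumpChain_le_pow hU0 hU1 hf_range hN Q hQ fun q hq => by
      obtain ⟨⟨i, rfl⟩, hsub⟩ := hQ' q hq
      exact hvis i (tsum_eventLaw_centre_eq_top hR hU0 hU1 hf_range hf0 hf_supp hN hsub)
    have hpow : Tendsto (fun k : ℕ => ENNReal.ofReal ((1 - U) ^ k)) atTop (𝓝 0) := by
      rw [← ENNReal.ofReal_zero]
      exact ENNReal.tendsto_ofReal (tendsto_pow_atTop_nhds_zero_of_lt_one (by linarith)
        (by linarith))
    rw [ENNReal.tendsto_nhds_zero]
    intro ε hε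
    obtain ⟨k, hk⟩ := ((ENNReal.tendsto_nhds_zero.1 hpow) ε hε).exists
    obtain ⟨n₀, -, hn₀⟩ := hdecay k
    filter_upwards [eventually_ge_atTop
      (jumpTime R U f (e · ω) (c · ω) (v · ω) n₀).toNNReal] with t ht
    obtain ⟨n, hn1, hn2⟩ := hindex t
    have hn : n₀ ≤ n := by
      by_contra! h
      have h1 : jumpTime R U f (e · ω) (c · ω) (v · ω) n₀ ≤ t := by
        rw [← ENNReal.coe_toNNReal (hfin n₀)]
        exact ENNReal.coe_le_coe.2 ht
      exact absurd (hn2.trans_le (jumpTime_mono (Nat.succ_le_of_lt h))) h1.not_gt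
    refine iSup₂_le fun z _ => ?_
    rw [hω n t hn1 hn2, Real.enorm_of_nonneg (jumpChain_mem_Icc hU0 hU1 hf_range n z).1]
    exact (ENNReal.ofReal_le_ofReal (hn₀ n hn z)).trans hk
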